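/- **Setting.** Identify $\mathbb R^2\cong\mathbb C$. Let $\Lambda=\mathbb Z^2$ or $\Lambda=A_{\rm tri}\mathbb Z^2$ with $A_{\rm tri}=\begin{pmatrix}1&1/2\\0&\sqrt3/2\end{pmatrix}$, and let $Q_\Lambda$ be the rotation by $\pi/2$, respectively $2\pi/3$. Let $\mathcal R\subset\Lambda\setminus\{0\}$ be finite with $\operatorname{span}_{\mathbb Z}\mathcal R=\Lambda$, and write $Du(x)=(u(x+\rho)-u(x))_{\rho\in\mathcal R}$ for $u:\Lambda\to\mathbb R$. Let $V\in C^6(\mathbb R^{\mathcal R})$ be such that * $Q_\Lambda\mathcal R=\mathcal R$ and $V(A)=V((A_{Q_\Lambda\rho})_{\rho\in\mathcal R})$ for all $A$; * there is a minimal $p>0$ with $V(A+p\,(\delta_{\rho\sigma})_{\sigma\in\mathcal R})=V(A)$ for all $A$ and all $\rho\in\mathcal R$; * (lattice stability) there is $c_0>0$ with $\sum_{x\in\Lambda}\nabla^2V(0)[Du(x),Du(x)]\ge c_0\|u\|_{\dot{\mathcal H}^1}^2$ for all $u\in\dot{\mathcal H}^1$. Here $\dot{\mathcal H}^1=\{u:\Lambda\to\mathbb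 R\mid Du\in\ell^2(\Lambda)\}/\mathbb R$ with $\|u\|_{\dot{\mathcal H}^1}=\big(\sum_{x\in\Lambda}|Du(x)|^2\big)^{1/2}$. Let $\mathcal H^c$ be the set of functions $\Lambda\to\mathbb R$ with bounded support and, for $\Omega\subset\Lambda$, let $\mathcal H^0(\Omega)=\{v\in\mathcal H^c\mid v=0\text{ on }\Lambda\setminus\Omega\}$. Let $b\in\{p,-p\}$, let $\hat x\in\mathbb R^2\setminus\Lambda$, and let $\hat u(x)=\frac{b}{2\pi}\arg(x-\hat x)$ with $\arg\in[0,2\pi)$. For $u_{\rm pred}\in\hat u+\dot{\mathcal H}^1$ let $\mathcal E(u_{\rm pred};\cdot):\dot{\mathcal H}^1\to\mathbb R$ be the continuous extension of $$\mathcal E(u_{\rm pred};u)=\sum_{x\in\Lambda}\Big(V\big(Du_{\rm pred}(x)+Du(x)\big)-V\big(Du_{\rm pred}(x)\big)\Big),\qquad u\in\mathcal H^c,$$ and write $\delta_u^2\mathcal E(u_{\rm pred};u)[v,v]=\frac{d^2}{dt^2}\big|_{t=0}\mathcal E(u_{\rm pred};u+tv)$. **Theorem 3.1.** Let $\tilde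 u\in\dot{\mathcal H}^1$ be a strongly stable solution of the predictor–corrector problem, that is, a local minimiser of $\mathcal E(u_{\rm pred};\cdot)$ on $\dot{\mathcal H}^1$ for which there is $c_1>0$ with $$\delta_u^2\mathcal E(u_{\rm pred};\tilde u)[v,v]\ge c_1\|v\|_{\dot{\mathcal H}^1}^2\qquad\text{for all }v\in\mathcal H^c.$$ Suppose that there are $s>1$, $r\in\{0,1\}$ and a constant $C_0$ such that $|D\tilde u(x)|\le C_0|x|^{-s}\log^r|x|$ for all $x\in\Lambda$ with $|x|$ large enough. Then there exist $C,R_0,c>0$ such that for every $R>R_0$ and every finite $\Omega_R$ with $B_R\cap\Lambda\subset\Omega_R\subset\Lambda$, where $B_R=\{|x|<R\}$, there is a stable supercell solution $\tilde u_R\in\mathcal H^0(\Omega_R)$, that is, a local minimiser of $\mathcal E(u_{\rm pred};\cdot)$ on $\mathcal H^0(\Omega_R)$ (in the topology of $\dot{\mathcal H}^1$) with $$\delta_u^2\mathcal E(u_{\rm pred};\tilde u_R)[v,v]\ge c\,\|v\|_{\dot{\mathcal H}^1}^2\qquad\text{for all }v\in\mathcal H^0(\Omega_R),$$ and it satisfies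 $$\|\tilde u_R-\tilde u\|_{\dot{\mathcal H}^1}\le C\,R^{1-s}\log^r R.$$ -/

import Mathlib

open Filter Topology Set

noncomputable section

namespace ScrewDislocation

/-! The plane is identified with the complex numbers, with the Euclidean norm. -/

/-- The two planar Bravais lattices under consideration. -/
inductive LatticeKind
  | square
  | triangular

/-- The second column of the lattice matrix; the first one is `1`. -/
def LatticeKind.tau : LatticeKind → ℂ
  | .square => ⟨0, 1⟩
  | .triangular => ⟨1 / 2, Real.sqrt 3 / 2⟩

/-- The rotation by `π / 2` (square) or `2 π / 3` (triangular), as a complex factor. -/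
def LatticeKind.rot : LatticeKind → ℂ
  | .square => ⟨0, 1⟩
  | .triangular => ⟨-1 / 2, Real.sqrt 3 / 2⟩

/-- The lattice: all integer combinations of `1` and `tau`. -/
def lattice (k : LatticeKind) : AddSubgroup ℂ where
  carrier := {z | ∃ m n : ℤ, z = (m : ℂ) + (n : ℂ) * k.tau}
  zero_mem' := ⟨0, 0, by simp⟩
  add_mem' := by
    rintro _ _ ⟨m, n, rfl⟩ ⟨m', n', rfl⟩
    exact ⟨m + m', n + n', by push_cast; ring⟩
  neg_mem' := by
    rintro _ ⟨m, n, rfl⟩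
    exact ⟨-m, -n, by push_cast; ring⟩

/-- Lattice sites. -/
abbrev Site (k : LatticeKind) : Type := ↥(lattice k)

variable {k : LatticeKind}

/-- The discrete gradient `(u (x + ρ) - u x)` for `ρ ∈ R`, with the Euclidean norm. -/
def grad (R : Finset (Site k)) (u : Site k → ℝ) (x : Site k) : EuclideanSpace ℝ R :=
  WithLp.toLp 2 fun ρ => u (x + ρ) - u x

theorem grad_add (R : Finset (Site k)) (u v : Site k → ℝ) :
    grad R (u + v) = grad R u + grad R v := by
  funext x; ext ρ; simp [grad]; ring

theorem grad_smul (R : Finset (Site k)) (c : ℝ) (u : Site k → ℝ) :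
    grad R (c • u) = c • grad R u := by
  funext x; ext ρ; simp [grad]; ring

/-- The displacements with square-summable discrete gradient. -/
def h1Submodule (R : Finset (Site k)) : Submodule ℝ (Site k → ℝ) where
  carrier := {u | Memℓp (grad R u) 2}
  zero_mem' := by
    have h : grad R (0 : Site k → ℝ) = 0 := by funext x; ext ρ; simp [grad]
    simpa [h] using (zero_memℓp (E := fun _ : Site k => EuclideanSpace ℝ R) (p := 2))
  add_mem' := by
    intro u v hu hv
    have := Memℓp.add hu hv
    simpa [grad_add] using this
  smul_mem' := by
    intro c u hu
    have := Memℓp.const_smul hu c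
    simpa [grad_smul] using this

/-- The energy space of displacements with square-summable discrete gradient. Its seminorm is
the `ℓ²` norm of the discrete gradient (see `HDot.norm_def`) and vanishes exactly on the
constants. Elements are representatives: convergence, local minimality, the norm and the energy
below depend only on the classes modulo constants. -/
def HDot (R : Finset (Site k)) : Type := ↥(h1Submodule R)

instance (R : Finset (Site k)) : AddCommGroup (HDot R) :=
  inferInstanceAs (AddCommGroup ↥(h1Submodule R))

instance (R : Finset (Site k)) : Module ℝ (HDot R) :=
  inferInstanceAs (Module ℝ ↥(h1Submodule R))

instance (R : Finset (Site k)) : CoeFun (HDot R) (fun _ => Site k → ℝ) := ⟨fun u => u.1⟩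

/-- The discrete gradient as a linear map into `ℓ²`. -/
def gradL (R : Finset (Site k)) :
    HDot R →ₗ[ℝ] lp (fun _ : Site k => EuclideanSpace ℝ R) 2 where
  toFun u := ⟨grad R u, u.2⟩
  map_add' u v := Subtype.ext (grad_add R u.1 v.1)
  map_smul' c u := Subtype.ext (grad_smul R c u.1)

instance (R : Finset (Site k)) : SeminormedAddCommGroup (HDot R) :=
  SeminormedAddCommGroup.induced (HDot R) (lp (fun _ : Site k => EuclideanSpace ℝ R) 2) (gradL R)

instance (R : Finset (Site k)) : NormedSpace ℝ (HDot R) :=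
  NormedSpace.induced ℝ (HDot R) (lp (fun _ : Site k => EuclideanSpace ℝ R) 2) (gradL R)

theorem HDot.norm_def (R : Finset (Site k)) (u : HDot R) :
    ‖u‖ = Real.sqrt (∑' x, ‖grad R u x‖ ^ 2) := by
  have h : ‖u‖ = ‖gradL R u‖ := rfl
  rw [h, lp.norm_eq_tsum_rpow (by norm_num), Real.sqrt_eq_rpow]
  simp [gradL]

/-- The space of compactly (that is, finitely) supported displacements. -/
def Hc (R : Finset (Site k)) : Set (HDot R) := {v | (Function.support (v : Site k → ℝ)).Finite}

/-- The Galerkin space: compactly supported displacements that vanish outside `Ω`. -/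
def H0 (R : Finset (Site k)) (Ω : Set (Site k)) : Set (HDot R) :=
  {v | v ∈ Hc R ∧ ∀ x ∉ Ω, v x = 0}

/-- The argument in `[0, 2 π)`: its branch cut is the half-line of nonnegative reals. -/
def argCut (z : ℂ) : ℝ := toIcoMod Real.two_pi_pos 0 z.arg

/-- The far-field predictor of a screw dislocation with core `xhat` and Burgers vector `b`. -/
def uHat (b : ℝ) (xhat : ℂ) (x : Site k) : ℝ := b / (2 * Real.pi) * argCut ((x : ℂ) - xhat)

/-- The energy difference for compactly supported `u` (the sum then has finitely many nonzero
terms). -/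
def energyC (R : Finset (Site k)) (V : EuclideanSpace ℝ R → ℝ) (uPred : Site k → ℝ)
    (u : HDot R) : ℝ :=
  ∑' x, (V (grad R uPred x + grad R u x) - V (grad R uPred x))

/-- The energy difference functional on the whole energy space: the extension by continuity
from the compactly supported displacements. -/
def energy (R : Finset (Site k)) (V : EuclideanSpace ℝ R → ℝ) (uPred : Site k → ℝ) :
    HDot R → ℝ :=
  extendFrom (Hc R) (energyC R V uPred)

/-- The second variation `δ²E(u)[v, v]` of a functional. -/
def secondVariation {R : Finset (Site k)} (E : HDot R → ℝ) (u v : HDot R) : ℝ :=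
  iteratedDeriv 2 (fun t : ℝ => E (u + t • v)) 0

/-- `V` is invariant under shifting any single strain component by `q`. -/
def IsSlipPeriod (R : Finset (Site k)) (V : EuclideanSpace ℝ R → ℝ) (q : ℝ) : Prop :=
  open scoped Classical in
  ∀ (A : EuclideanSpace ℝ R) (ρ : R), V (A + EuclideanSpace.single ρ q) = V A

/-- The standing assumptions on the interaction range `R`, the site potential `V`, the Burgers
vector `b` and the dislocation core `xhat`. -/
structure IsScrewModel (R : Finset (Site k)) (V : EuclideanSpace ℝ R → ℝ) (b : ℝ)
    (xhat : ℂ) : Prop where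
  zero_notMem : (0 : Site k) ∉ R
  span_eq_top : AddSubgroup.closure (R : Set (Site k)) = ⊤
  contDiff : ContDiff ℝ 6 V
  /-- `R` is mapped onto itself by the lattice rotation, and `V` is invariant under it. -/
  rotation : ∃ π : Equiv.Perm R, (∀ ρ : R, ((π ρ : Site k) : ℂ) = k.rot * ((ρ : Site k) : ℂ)) ∧
    ∀ A : EuclideanSpace ℝ R, V A = V (WithLp.toLp 2 fun ρ => A (π ρ))
  /-- The Burgers vector is plus or minus the minimal slip period of `V`. -/
  burgers : ∃ p : ℝ, IsLeast {q : ℝ | 0 < q ∧ IsSlipPeriod R V q} p ∧ (b = p ∨ b = -p)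
  /-- Lattice (phonon) stability. -/
  latticeStable : ∃ c₀ : ℝ, 0 < c₀ ∧ ∀ u : HDot R,
    c₀ * ‖u‖ ^ 2 ≤ ∑' x, iteratedFDeriv ℝ 2 V 0 ![grad R u x, grad R u x]
  core_notMem : xhat ∉ lattice k

end ScrewDislocation

end

/-!
Write `z` for the position relative to the core. The strain of the far-field predictor has integer
jumps across the branch cut, which slip invariance removes from the stress; what remains is
`Im (ρ / z)` up to `O(|z|⁻²)`, which is square summable. Modulo forces that are bounded in the
energy norm, the predictor therefore exerts the force of a linear combination of the harmonic
stresses `Im (c / z)`. On lattice vectors, second differences of `log |z|` are symmetric, which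
leaves only a multiple of the moments `∑ c ρ` and `Im ∑ c conj ρ`; the former vanishes by the
rotational symmetry of the lattice, the latter by the symmetry of the Hessian. Hence the energy is a
bounded linear functional plus a superposition of second-order Taylor remainders of `V`, with
uniform Taylor bounds.

A truncation `v` of the solution `u` on a ball of radius `R` is `O(R^(1-s) log^r R)`-close to it,
and the energy is uniformly convex near `u`. On a finite-dimensional Galerkin space containing `v`,
the minimum over a small ball around `u` is therefore interior and within a constant multiple of
`‖v - u‖` of `u`.
-/

noncomputable section

namespace ScrewDislocation

open scoped NNReal

variable {k : LatticeKind}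

/-! ### Functionals with uniform Taylor bounds -/

section TaylorBounds

/-- `f` is twice differentiable with derivatives `f'` and `f''`, and `f''` is bounded by `M` and
`M`-Lipschitz. Differentiability is expressed by quadratic Taylor remainders, so that the notion
makes sense on the seminormed energy space. -/
structure TaylorBounds {X : Type*} [SeminormedAddCommGroup X] [NormedSpace ℝ X] (f : X → ℝ)
    (f' : X → X →L[ℝ] ℝ) (f'' : X → X →L[ℝ] X →L[ℝ] ℝ) (M : ℝ≥0) : Prop where
  norm_hess_le : ∀ u, ‖f'' u‖ ≤ M
  norm_hess_sub_le : ∀ u z, ‖f'' (u + z) - f'' u‖ ≤ M * ‖z‖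
  norm_deriv_remainder_le : ∀ u z, ‖f' (u + z) - f' u - f'' u z‖ ≤ M * ‖z‖ ^ 2
  norm_remainder_le : ∀ u z, ‖f (u + z) - f u - f' u z‖ ≤ M * ‖z‖ ^ 2

theorem hasDerivAt_of_norm_remainder_le {φ : ℝ → ℝ} {φ' C t : ℝ}
    (h : ∀ ε, ‖φ (t + ε) - φ t - ε * φ'‖ ≤ C * ε ^ 2) : HasDerivAt φ φ' t := by
  rw [hasDerivAt_iff_isLittleO_nhds_zero]
  have hO : (fun ε => φ (t + ε) - φ t - ε • φ') =O[𝓝 0] fun ε : ℝ => ε ^ 2 :=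
    Asymptotics.IsBigO.of_bound C <| .of_forall fun ε => by simpa using h ε
  exact hO.trans_isLittleO <| by simpa using Asymptotics.isLittleO_pow_pow one_lt_two

theorem norm_remainder_le_of_lipschitz_fderiv {F G : Type*} [NormedAddCommGroup F]
    [NormedSpace ℝ F] [NormedAddCommGroup G] [NormedSpace ℝ G] {f : F → G}
    (hf : Differentiable ℝ f) {M : ℝ} (hM : 0 ≤ M)
    (hlip : ∀ u z, ‖fderiv ℝ f (u + z) - fderiv ℝ f u‖ ≤ M * ‖z‖) (u z : F) :
    ‖f (u + z) - f u - fderiv ℝ f u z‖ ≤ M * ‖z‖ ^ 2 := by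
  have hball : ∀ y ∈ Metric.closedBall u ‖z‖, ‖fderiv ℝ f y - fderiv ℝ f u‖ ≤ M * ‖z‖ := by
    intro y hy
    calc ‖fderiv ℝ f y - fderiv ℝ f u‖ ≤ M * ‖y - u‖ := by simpa using hlip u (y - u)
      _ ≤ M * ‖z‖ := by gcongr; exact mem_closedBall_iff_norm.1 hy
  have hmvt := (convex_closedBall u ‖z‖).norm_image_sub_le_of_norm_fderiv_le'
    (fun y _ => hf y) hball (Metric.mem_closedBall_self (norm_nonneg z))
    (show u + z ∈ Metric.closedBall u ‖z‖ by simp)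
  simpa only [add_sub_cancel_left, mul_assoc, sq] using hmvt

namespace TaylorBounds

variable {X Y : Type*} [SeminormedAddCommGroup X] [NormedSpace ℝ X] [SeminormedAddCommGroup Y]
  [NormedSpace ℝ Y] {f : X → ℝ} {f' : X → X →L[ℝ] ℝ} {f'' : X → X →L[ℝ] X →L[ℝ] ℝ} {M : ℝ≥0}

theorem of_contDiff {F : Type*} [NormedAddCommGroup F] [NormedSpace ℝ F] {V : F → ℝ}
    (hV : ContDiff ℝ 2 V) (hbound : ∀ A, ‖fderiv ℝ (fderiv ℝ V) A‖ ≤ M)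
    (hlip : ∀ A B, ‖fderiv ℝ (fderiv ℝ V) (A + B) - fderiv ℝ (fderiv ℝ V) A‖ ≤ M * ‖B‖) :
    TaylorBounds V (fderiv ℝ V) (fderiv ℝ (fderiv ℝ V)) M := by
  have hdiff : Differentiable ℝ (fderiv ℝ V) :=
    (hV.fderiv_right (m := 1) (by norm_num)).differentiable one_ne_zero
  refine ⟨hbound, hlip, norm_remainder_le_of_lipschitz_fderiv hdiff M.2 hlip,
    norm_remainder_le_of_lipschitz_fderiv (hV.differentiable two_ne_zero) M.2 fun A B => ?_⟩
  simpa using convex_univ.norm_image_sub_le_of_norm_fderiv_le (fun x _ => hdiff x)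
    (fun x _ => hbound x) (mem_univ A) (mem_univ (A + B))

theorem hasDerivAt_line (h : TaylorBounds f f' f'' M) (u z : X) (t : ℝ) :
    HasDerivAt (fun t : ℝ => f (u + t • z)) (f' (u + t • z) z) t := by
  refine hasDerivAt_of_norm_remainder_le (C := M * ‖z‖ ^ 2) fun ε => ?_
  have := h.norm_remainder_le (u + t • z) (ε • z)
  rw [map_smul, smul_eq_mul, norm_smul, mul_pow, Real.norm_eq_abs ε, sq_abs] at this
  rw [add_smul, ← add_assoc]
  exact this.trans_eq (by ring)

theorem hasDerivAt_deriv_line (h : TaylorBounds f f' f'' M) (u z v : X) (t : ℝ) :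
    HasDerivAt (fun t : ℝ => f' (u + t • z) v) (f'' (u + t • z) z v) t := by
  refine hasDerivAt_of_norm_remainder_le (C := M * ‖z‖ ^ 2 * ‖v‖) fun ε => ?_
  have := (f' (u + t • z + ε • z) - f' (u + t • z) - f'' (u + t • z) (ε • z)).le_of_opNorm_le
    (h.norm_deriv_remainder_le (u + t • z) (ε • z)) v
  rw [norm_smul, mul_pow, Real.norm_eq_abs ε, sq_abs] at this
  rw [add_smul, ← add_assoc]
  simp only [sub_apply, map_smul, smul_apply, smul_eq_mul] at this
  exact this.trans_eq (by ring)

theorem iteratedDeriv_two_line (h : TaylorBounds f f' f'' M) (u v : X) :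
    iteratedDeriv 2 (fun t : ℝ => f (u + t • v)) 0 = f'' u v v := by
  have h1 : deriv (fun t : ℝ => f (u + t • v)) = fun t => f' (u + t • v) v :=
    funext fun t => (h.hasDerivAt_line u v t).deriv
  rw [iteratedDeriv_succ, iteratedDeriv_one, h1, (h.hasDerivAt_deriv_line u v v 0).deriv,
    zero_smul, add_zero]

theorem continuous (h : TaylorBounds f f' f'' M) : Continuous f := by
  refine continuous_iff_continuousAt.2 fun u => ?_
  have hlim : Tendsto (fun y => f u + f' u (y - u) + M * ‖y - u‖ ^ 2) (𝓝 u) (𝓝 (f u)) :=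
    Continuous.tendsto' (by fun_prop) _ _ (by simp)
  have hlim' : Tendsto (fun y => f u + f' u (y - u) - M * ‖y - u‖ ^ 2) (𝓝 u) (𝓝 (f u)) :=
    Continuous.tendsto' (by fun_prop) _ _ (by simp)
  refine tendsto_of_tendsto_of_tendsto_of_le_of_le hlim' hlim (fun y => ?_) fun y => ?_ <;>
  · have := abs_le.1 (h.norm_remainder_le u (y - u))
    rw [add_sub_cancel] at this
    dsimp only
    linarith

theorem norm_deriv_sub_le (h : TaylorBounds f f' f'' M) (u z : X) :
    ‖f' (u + z) - f' u‖ ≤ M * ‖z‖ := by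
  refine ContinuousLinearMap.opNorm_le_bound _ (by positivity) fun v => ?_
  have hmvt := norm_image_sub_le_of_norm_deriv_le_segment_01'
    (fun t _ => (h.hasDerivAt_deriv_line u z v t).hasDerivWithinAt)
    (fun t _ => (f'' (u + t • z)).le_of_opNorm₂_le_of_le (h.norm_hess_le _) le_rfl le_rfl)
  simpa using hmvt

theorem norm_second_remainder_le (h : TaylorBounds f f' f'' M) (u z : X) :
    ‖f (u + z) - f u - f' u z - f'' u z z / 2‖ ≤ M * ‖z‖ ^ 3 := by
  have hderiv : ∀ t : ℝ, HasDerivAt (fun t : ℝ => f (u + t • z) - t * f' u z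
      - t ^ 2 * (f'' u z z / 2)) (f' (u + t • z) z - f' u z - t * f'' u z z) t := fun t => by
    refine (((h.hasDerivAt_line u z t).sub ((hasDerivAt_id t).mul_const (f' u z))).sub
      ((hasDerivAt_pow 2 t).mul_const (f'' u z z / 2))).congr_deriv ?_
    push_cast
    ring
  have hbound : ∀ t ∈ Ico (0 : ℝ) 1,
      ‖f' (u + t • z) z - f' u z - t * f'' u z z‖ ≤ M * ‖z‖ ^ 3 := fun t ht => by
    have htz : ‖t • z‖ ≤ ‖z‖ := by
      rw [norm_smul, Real.norm_of_nonneg ht.1]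
      exact mul_le_of_le_one_left (norm_nonneg z) ht.2.le
    have := (f' (u + t • z) - f' u - f'' u (t • z)).le_of_opNorm_le
      (h.norm_deriv_remainder_le u (t • z)) z
    simp only [sub_apply, map_smul, smul_apply, smul_eq_mul] at this
    calc _ ≤ M * ‖t • z‖ ^ 2 * ‖z‖ := this
      _ ≤ M * ‖z‖ ^ 2 * ‖z‖ := by gcongr
      _ = M * ‖z‖ ^ 3 := by ring
  have hmvt := norm_image_sub_le_of_norm_deriv_le_segment_01'
    (fun t _ => (hderiv t).hasDerivWithinAt) hbound
  calc _ = ‖f (u + z) - f' u z - f'' u z z / 2 - f u‖ := by congr 1; ring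
    _ ≤ M * ‖z‖ ^ 3 := by simpa using hmvt

theorem add_continuousLinearMap (h : TaylorBounds f f' f'' M) (L : X →L[ℝ] ℝ) :
    TaylorBounds (fun u => L u + f u) (fun u => L + f' u) f'' M where
  norm_hess_le := h.norm_hess_le
  norm_hess_sub_le := h.norm_hess_sub_le
  norm_deriv_remainder_le u z := by
    simpa only [add_sub_add_left_eq_sub] using h.norm_deriv_remainder_le u z
  norm_remainder_le u z := by
    convert h.norm_remainder_le u z using 2
    rw [map_add, add_apply]
    ring

theorem comp_linearIsometry (h : TaylorBounds f f' f'' M) (T : Y →ₗᵢ[ℝ] X) :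
    TaylorBounds (fun u => f (T u)) (fun u => (f' (T u)).comp T.toContinuousLinearMap)
      (fun u => (f'' (T u)).bilinearComp T.toContinuousLinearMap T.toContinuousLinearMap) M where
  norm_hess_le u := ContinuousLinearMap.opNorm_le_bound₂ _ M.2 fun v w => by
    simpa using (f'' (T u)).le_of_opNorm₂_le_of_le (h.norm_hess_le _) (T.norm_map v).le
      (T.norm_map w).le
  norm_hess_sub_le u z := ContinuousLinearMap.opNorm_le_bound₂ _ (by positivity) fun v w => by
    simpa using (f'' (T u + T z) - f'' (T u)).le_of_opNorm₂_le_of_le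
      (h.norm_hess_sub_le (T u) (T z)) (T.norm_map v).le (T.norm_map w).le
  norm_deriv_remainder_le u z := ContinuousLinearMap.opNorm_le_bound _ (by positivity) fun v => by
    simpa using (f' (T u + T z) - f' (T u) - f'' (T u) (T z)).le_of_opNorm_le_of_le
      (h.norm_deriv_remainder_le (T u) (T z)) (T.norm_map v).le
  norm_remainder_le u z := by simpa using h.norm_remainder_le (T u) (T z)

end TaylorBounds

end TaylorBounds

/-! ### Superposition functionals on `ℓ²` -/

section Superposition

variable {ι F : Type*} [NormedAddCommGroup F]

theorem holderConjugate_two_toReal : (2 : ENNReal).toReal.HolderConjugate (2 : ENNReal).toReal := by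
  simpa using Real.HolderConjugate.two_two

theorem summable_norm_sq (h : lp (fun _ : ι => F) 2) : Summable fun x => ‖h x‖ ^ 2 := by
  simpa using (lp.memℓp h).summable (by norm_num)

theorem tsum_norm_sq (h : lp (fun _ : ι => F) 2) : ∑' x, ‖h x‖ ^ 2 = ‖h‖ ^ 2 := by
  simpa using (lp.norm_rpow_eq_tsum (p := 2) (by norm_num) h).symm

theorem summable_of_norm_le_mul {f : ι → ℝ} {C : ℝ} {h l : lp (fun _ : ι => F) 2}
    (hf : ∀ x, ‖f x‖ ≤ C * (‖h x‖ * ‖l x‖)) : Summable f :=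
  .of_norm_bounded ((lp.summable_mul holderConjugate_two_toReal h l).mul_left C) hf

theorem norm_tsum_le_of_norm_le_mul {f : ι → ℝ} {C : ℝ} (hC : 0 ≤ C)
    {h l : lp (fun _ : ι => F) 2} (hf : ∀ x, ‖f x‖ ≤ C * (‖h x‖ * ‖l x‖)) :
    ‖∑' x, f x‖ ≤ C * (‖h‖ * ‖l‖) := by
  have hmul := lp.summable_mul holderConjugate_two_toReal h l
  calc ‖∑' x, f x‖ ≤ ∑' x, C * (‖h x‖ * ‖l x‖) :=
        tsum_of_norm_bounded (hmul.mul_left C).hasSum hf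
    _ ≤ C * (‖h‖ * ‖l‖) := by
      rw [tsum_mul_left]
      gcongr
      exact lp.tsum_mul_le_mul_norm' holderConjugate_two_toReal h l

variable [NormedSpace ℝ F] {V : F → ℝ} {V' : F → F →L[ℝ] ℝ} {V'' : F → F →L[ℝ] F →L[ℝ] ℝ}
  {M : ℝ≥0}

/-- The energy of the strain `g + h` relative to that of `g`, after subtraction of the first
variation at `g`, so that the sum converges for every square-summable `h`. -/
def superposition (V : F → ℝ) (V' : F → F →L[ℝ] ℝ) (g : ι → F) (h : lp (fun _ : ι => F) 2) : ℝ :=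
  ∑' x, (V (g x + h x) - V (g x) - V' (g x) (h x))

/-- The first derivative of `superposition V V' g`. -/
def superpositionDeriv (hV : TaylorBounds V V' V'' M) (g : ι → F) (h : lp (fun _ : ι => F) 2) :
    lp (fun _ : ι => F) 2 →L[ℝ] ℝ :=
  lp.dualPairing 2 2 (K := 1) (fun _ => .id ℝ (F →L[ℝ] ℝ))
    (fun _ => by simpa using ContinuousLinearMap.norm_id_le)
    ⟨fun x => V' (g x + h x) - V' (g x),
      .of_norm <| ((lp.memℓp h).norm.const_smul (M : ℝ)).mono fun x => by
        simpa using hV.norm_deriv_sub_le (g x) (h x)⟩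

/-- The second derivative of `superposition V V' g`. -/
def superpositionHess (hV : TaylorBounds V V' V'' M) (g : ι → F) (h : lp (fun _ : ι => F) 2) :
    lp (fun _ : ι => F) 2 →L[ℝ] lp (fun _ : ι => F) 2 →L[ℝ] ℝ :=
  lp.dualPairing 2 2 (fun x => V'' (g x + h x)) fun x => hV.norm_hess_le (g x + h x)

theorem superpositionDeriv_hasSum (hV : TaylorBounds V V' V'' M) (g : ι → F)
    (h z : lp (fun _ : ι => F) 2) :
    HasSum (fun x => (V' (g x + h x) - V' (g x)) (z x)) (superpositionDeriv hV g h z) :=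
  (summable_of_norm_le_mul (h := h) (l := z) fun x => by
    rw [← mul_assoc]
    exact ContinuousLinearMap.le_of_opNorm_le _ (hV.norm_deriv_sub_le (g x) (h x)) (z x)).hasSum

theorem superpositionHess_hasSum (hV : TaylorBounds V V' V'' M) (g : ι → F)
    (h z v : lp (fun _ : ι => F) 2) :
    HasSum (fun x => V'' (g x + h x) (z x) (v x)) (superpositionHess hV g h z v) :=
  (summable_of_norm_le_mul (h := z) (l := v) fun x => by
    rw [← mul_assoc]
    exact (V'' _).le_of_opNorm₂_le_of_le (hV.norm_hess_le _) le_rfl le_rfl).hasSum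

theorem superposition_hasSum (hV : TaylorBounds V V' V'' M) (g : ι → F)
    (h : lp (fun _ : ι => F) 2) :
    HasSum (fun x => V (g x + h x) - V (g x) - V' (g x) (h x)) (superposition V V' g h) :=
  (summable_of_norm_le_mul (h := h) (l := h) fun x => by
    rw [← sq]; exact hV.norm_remainder_le (g x) (h x)).hasSum

theorem taylorBounds_superposition (hV : TaylorBounds V V' V'' M) (g : ι → F) :
    TaylorBounds (superposition V V' g) (superpositionDeriv hV g) (superpositionHess hV g) M where
  norm_hess_le h := lp.norm_dualPairing _ _
  norm_hess_sub_le h z := by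
    refine ContinuousLinearMap.opNorm_le_bound₂ _ (by positivity) fun v w => ?_
    rw [sub_apply, sub_apply, ← ((superpositionHess_hasSum hV g (h + z) v w).sub
      (superpositionHess_hasSum hV g h v w)).tsum_eq, mul_assoc]
    refine norm_tsum_le_of_norm_le_mul (by positivity) fun x => ?_
    rw [← mul_assoc, lp.coeFn_add, Pi.add_apply, ← add_assoc]
    refine (V'' (g x + h x + z x) - V'' (g x + h x)).le_of_opNorm₂_le_of_le ?_ le_rfl le_rfl
    refine (hV.norm_hess_sub_le _ _).trans ?_
    gcongr
    exact lp.norm_apply_le_norm two_ne_zero z x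
  norm_deriv_remainder_le h z := by
    refine ContinuousLinearMap.opNorm_le_bound _ (by positivity) fun v => ?_
    rw [sub_apply, sub_apply, ← (((superpositionDeriv_hasSum hV g (h + z) v).sub
      (superpositionDeriv_hasSum hV g h v)).sub (superpositionHess_hasSum hV g h z v)).tsum_eq]
    calc _ ≤ M * ‖z‖ * (‖z‖ * ‖v‖) := norm_tsum_le_of_norm_le_mul (by positivity) fun x => ?_
      _ = M * ‖z‖ ^ 2 * ‖v‖ := by ring
    have hx := (V' (g x + h x + z x) - V' (g x + h x) - V'' (g x + h x) (z x)).le_of_opNorm_le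
      (hV.norm_deriv_remainder_le (g x + h x) (z x)) (v x)
    calc _ ≤ M * ‖z x‖ ^ 2 * ‖v x‖ := by simpa [add_assoc] using hx
      _ = M * ‖z x‖ * (‖z x‖ * ‖v x‖) := by ring
      _ ≤ M * ‖z‖ * (‖z x‖ * ‖v x‖) := by
        gcongr
        exact lp.norm_apply_le_norm two_ne_zero z x
  norm_remainder_le h z := by
    rw [← (((superposition_hasSum hV g (h + z)).sub (superposition_hasSum hV g h)).sub
      (superpositionDeriv_hasSum hV g h z)).tsum_eq, sq]
    refine norm_tsum_le_of_norm_le_mul M.coe_nonneg fun x => ?_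
    rw [← sq]
    convert hV.norm_remainder_le (g x + h x) (z x) using 2
    simp only [lp.coeFn_add, Pi.add_apply, map_add, sub_apply, add_assoc]
    ring

end Superposition

/-! ### Galerkin approximation of a strongly stable critical point -/

section Galerkin

theorem isCompact_closedBall_of_finiteDimensional {W : Type*} [SeminormedAddCommGroup W]
    [NormedSpace ℝ W] [FiniteDimensional ℝ W] (x : W) (r : ℝ) :
    IsCompact (Metric.closedBall x r) := by
  have : FiniteDimensional ℝ (SeparationQuotient W) :=
    .of_surjective (SeparationQuotient.mkCLM ℝ W).toLinearMap SeparationQuotient.surjective_mk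
  have := FiniteDimensional.proper_real (SeparationQuotient W)
  have himage : SeparationQuotient.mk '' Metric.closedBall x r
      = Metric.closedBall (SeparationQuotient.mk x) r := by
    ext y
    obtain ⟨y, rfl⟩ := SeparationQuotient.surjective_mk y
    refine ⟨?_, fun hy => ⟨y, by
      simpa [SeparationQuotient.dist_mk] using hy, rfl⟩⟩
    rintro ⟨z, hz, hzy⟩
    simpa [← hzy, SeparationQuotient.dist_mk] using hz
  rw [SeparationQuotient.isInducing_mk.isCompact_iff, himage]
  exact isCompact_closedBall _ _

variable {X : Type*} [SeminormedAddCommGroup X] [NormedSpace ℝ X] {f : X → ℝ}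
  {f' : X → X →L[ℝ] ℝ} {f'' : X → X →L[ℝ] X →L[ℝ] ℝ} {M : ℝ≥0} {W : Submodule ℝ X}

theorem exists_isLocalMinOn_of_lt_sphere (hf : Continuous f) [FiniteDimensional ℝ W] {a : X}
    (ha : a ∈ W) {δ : ℝ} (hδ : 0 ≤ δ) (hlt : ∀ v ∈ W, ‖v‖ = δ → f a < f (a + v)) :
    ∃ m ∈ W, IsLocalMinOn f W m ∧ ‖m - a‖ ≤ δ := by
  lift a to W using ha
  obtain ⟨m, hm, hmin⟩ := (isCompact_closedBall_of_finiteDimensional a δ).exists_isLocalMin_mem_open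
    Metric.ball_subset_closedBall (hf.comp continuous_subtype_val).continuousOn
    (Metric.mem_closedBall_self hδ)
    (fun y hy => by
      rw [Metric.closedBall_sdiff_ball, mem_sphere_iff_norm] at hy
      simpa using hlt (y - a : W) (y - a).2 hy)
    Metric.isOpen_ball
  refine ⟨m, m.2, ?_, (mem_ball_iff_norm.1 hm).le⟩
  rw [IsLocalMinOn, IsMinFilter, ← map_nhds_subtype_val (s := (W : Set X)) m]
  exact hmin

theorem TaylorBounds.coercive_add (h : TaylorBounds f f' f'' M) {u : X} {c : ℝ}
    (hcoer : ∀ v ∈ W, c * ‖v‖ ^ 2 ≤ f'' u v v) (z : X) {v : X} (hv : v ∈ W) :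
    (c - M * ‖z‖) * ‖v‖ ^ 2 ≤ f'' (u + z) v v := by
  have hdiff : |f'' (u + z) v v - f'' u v v| ≤ M * ‖z‖ * ‖v‖ * ‖v‖ :=
    (f'' (u + z) - f'' u).le_of_opNorm₂_le_of_le (h.norm_hess_sub_le u z) le_rfl le_rfl
  linarith [hcoer v hv, (abs_le.1 hdiff).1]

theorem TaylorBounds.exists_isLocalMinOn_of_near (h : TaylorBounds f f' f'' M)
    [FiniteDimensional ℝ W] {u a : X} {c η : ℝ} (hc : 0 < c) (hη : 0 < η)
    (hcrit : ∀ v ∈ W, f' u v = 0) (hcoer : ∀ v ∈ W, c * ‖v‖ ^ 2 ≤ f'' u v v) (ha : a ∈ W)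
    (hau : ‖a - u‖ ≤ η) (hsmall : M * ((8 * M / c + 2) * η) ≤ c / 8) :
    ∃ m ∈ W, IsLocalMinOn f W m ∧ (∀ v ∈ W, c / 2 * ‖v‖ ^ 2 ≤ f'' m v v) ∧
      ‖m - u‖ ≤ (8 * M / c + 2) * η := by
  set δ := (8 * M / c + 1) * η with hδ
  have hM : M * η ≤ c / 8 * δ := by
    rw [hδ]; field_simp; nlinarith [M.coe_nonneg]
  have hδ₀ : 0 < δ := by positivity
  have hsum : (8 * M / c + 2) * η = δ + η := by rw [hδ]; ring
  rw [hsum] at hsmall ⊢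
  have hlt : ∀ v ∈ W, ‖v‖ = δ → f a < f (a + v) := fun v hv hvδ => by
    have hlin : |f' a v| ≤ M * η * δ := by
      have := (f' (u + (a - u)) - f' u).le_of_opNorm_le_of_le
        ((h.norm_deriv_sub_le u (a - u)).trans (mul_le_mul_of_nonneg_left hau M.coe_nonneg)) hvδ.le
      simpa [hcrit v hv] using this
    have hquad := h.coercive_add hcoer (a - u) hv
    have hrem := h.norm_second_remainder_le a v
    rw [hvδ] at hquad hrem
    have hδ₂ : 0 < δ ^ 2 := by positivity
    have := mul_le_mul_of_nonneg_right (mul_le_mul_of_nonneg_left hau M.coe_nonneg) hδ₂.le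
    have := mul_le_mul_of_nonneg_right hM hδ₀.le
    have := mul_le_mul_of_nonneg_right hsmall hδ₂.le
    rw [add_sub_cancel] at hquad
    nlinarith [(abs_le.1 hlin).1, (abs_le.1 hrem).1, mul_pos hc hδ₂,
      mul_nonneg (mul_nonneg M.coe_nonneg hη.le) hδ₂.le]
  obtain ⟨m, hmW, hmin, hma⟩ :=
    exists_isLocalMinOn_of_lt_sphere h.continuous ha (by positivity) hlt
  have hmu : ‖m - u‖ ≤ δ + η := (norm_sub_le_norm_sub_add_norm_sub m a u).trans (add_le_add hma hau)
  refine ⟨m, hmW, hmin, fun v hv => ?_, hmu⟩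
  have := h.coercive_add hcoer (m - u) hv
  rw [add_sub_cancel] at this
  refine le_trans ?_ this
  gcongr
  have := mul_le_mul_of_nonneg_left hmu M.coe_nonneg
  linarith

end Galerkin

/-! ### Periodic site potentials -/

section SlipInvariant

variable {ι G : Type*}

/-- Invariance of a function of the strain under slip, that is, under adding integer multiples of
`p` to all strain components. -/
def SlipInvariant (p : ℝ) (f : EuclideanSpace ℝ ι → G) : Prop :=
  ∀ (n : ι → ℤ) (A : EuclideanSpace ℝ ι), f (A + WithLp.toLp 2 fun ρ => n ρ * p) = f A

variable [NormedAddCommGroup G] {f : EuclideanSpace ℝ ι → G} {p : ℝ}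

theorem IsSlipPeriod.slipInvariant {R : Finset (Site k)} {V : EuclideanSpace ℝ R → ℝ}
    (h : IsSlipPeriod R V p) : SlipInvariant p V := by
  classical
  intro n A
  let S : AddSubgroup (EuclideanSpace ℝ R) :=
    { carrier := {T | ∀ A, V (A + T) = V A}
      zero_mem' := fun A => by rw [add_zero]
      add_mem' := fun ha hb A => by rw [← add_assoc, hb, ha]
      neg_mem' := fun {a} ha A => by rw [← ha (A + -a), neg_add_cancel_right] }
  have hsingle : ∀ ρ, EuclideanSpace.single ρ p ∈ S := fun ρ A => by convert h A ρ
  have hsum : WithLp.toLp 2 (fun ρ => n ρ * p) = ∑ ρ, n ρ • EuclideanSpace.single ρ p := by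
    ext σ
    simp [Pi.single_apply]
  rw [hsum]
  exact (sum_mem fun ρ _ => S.zsmul_mem (hsingle ρ) _ : _ ∈ S) A

theorem SlipInvariant.exists_norm_le (h : SlipInvariant p f) (hp : 0 < p) (hf : Continuous f) :
    ∃ M, ∀ A, ‖f A‖ ≤ M := by
  have hcell : IsCompact (WithLp.toLp 2 '' univ.pi fun _ : ι => Icc (0 : ℝ) p) :=
    (isCompact_univ_pi fun _ => isCompact_Icc).image (PiLp.continuous_toLp 2 _)
  obtain ⟨M, hM⟩ := hcell.exists_bound_of_continuousOn hf.continuousOn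
  refine ⟨M, fun A => ?_⟩
  have hA : WithLp.toLp 2 (fun ρ => toIcoMod hp 0 (A ρ))
      + WithLp.toLp 2 (fun ρ => (toIcoDiv hp 0 (A ρ) : ℝ) * p) = A := by
    ext ρ
    simp [← zsmul_eq_mul]
  rw [← hA, h]
  refine hM _ ⟨_, fun ρ _ => ?_, rfl⟩
  simpa using Ico_subset_Icc_self (toIcoMod_mem_Ico hp 0 (A ρ))

theorem SlipInvariant.fderiv [Finite ι] [NormedSpace ℝ G] (h : SlipInvariant p f) :
    SlipInvariant p (fderiv ℝ f) := fun n A => by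
  have := Fintype.ofFinite ι
  rw [← fderiv_comp_add_right]
  exact congrArg (_root_.fderiv ℝ · A) (funext (h n))

variable [Fintype ι]

theorem SlipInvariant.exists_norm_sub_le [NormedSpace ℝ G] (h : SlipInvariant p f) (hp : 0 < p)
    (hf : ContDiff ℝ 1 f) : ∃ M, ∀ A B, ‖f (A + B) - f A‖ ≤ M * ‖B‖ := by
  obtain ⟨M, hM⟩ := h.fderiv.exists_norm_le hp (hf.continuous_fderiv one_ne_zero)
  refine ⟨M, fun A B => ?_⟩
  simpa using convex_univ.norm_image_sub_le_of_norm_fderiv_le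
    (fun x _ => hf.differentiable one_ne_zero x) (fun x _ => hM x) (mem_univ A) (mem_univ (A + B))

theorem SlipInvariant.exists_taylorBounds {V : EuclideanSpace ℝ ι → ℝ} (h : SlipInvariant p V)
    (hp : 0 < p) (hV : ContDiff ℝ 3 V) :
    ∃ M, TaylorBounds V (_root_.fderiv ℝ V) (_root_.fderiv ℝ (_root_.fderiv ℝ V)) M := by
  have hV' : ContDiff ℝ 2 (_root_.fderiv ℝ V) := hV.fderiv_right (by norm_num)
  have hV'' : ContDiff ℝ 1 (_root_.fderiv ℝ (_root_.fderiv ℝ V)) := hV'.fderiv_right (by norm_num)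
  obtain ⟨M, hM⟩ := h.fderiv.fderiv.exists_norm_le hp hV''.continuous
  obtain ⟨M', hM'⟩ := h.fderiv.fderiv.exists_norm_sub_le hp hV''
  refine ⟨(max M M').toNNReal, .of_contDiff (hV.of_le (by norm_num)) (fun A => ?_) fun A B => ?_⟩
  · exact (hM A).trans ((le_max_left _ _).trans (Real.le_coe_toNNReal _))
  · refine (hM' A B).trans ?_
    gcongr
    exact (le_max_right _ _).trans (Real.le_coe_toNNReal _)

end SlipInvariant

/-! ### The energy on the closure of the compactly supported displacements -/

section Energy

variable {R : Finset (Site k)}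

theorem finite_support_grad {v : Site k → ℝ} (hv : v.support.Finite) :
    (Function.support (grad R v)).Finite := by
  refine (hv.union (R.finite_toSet.biUnion fun ρ _ =>
    hv.preimage (add_left_injective ρ).injOn)).subset fun x hx => ?_
  contrapose! hx
  simp only [mem_union, mem_iUnion, mem_preimage, Function.mem_support, not_or, not_exists,
    not_not] at hx
  rw [Function.mem_support, not_not]
  ext ρ
  simp [grad, hx.1, hx.2 ρ.1 ρ.2]

theorem summable_clm_grad (φ : Site k → EuclideanSpace ℝ R →L[ℝ] ℝ) {v : HDot R} (hv : v ∈ Hc R) :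
    Summable fun x => φ x (grad R v x) :=
  summable_of_hasFiniteSupport <|
    (finite_support_grad (R := R) hv).subset fun x hx hx' => hx (by simp [hx'])

/-- A finitely supported function as an element of the energy space. -/
def ofFinite (R : Finset (Site k)) (v : Site k → ℝ) (hv : v.support.Finite) : HDot R :=
  ⟨v, (memℓp_zero (finite_support_grad hv) : Memℓp (grad R v) 0).of_exponent_ge zero_le⟩

/-- The set `H0 R Ω` as a subspace of the energy space. -/
def H0Submodule (R : Finset (Site k)) (Ω : Set (Site k)) : Submodule ℝ (HDot R) where
  carrier := H0 R Ω
  zero_mem' := ⟨show (Function.support (0 : Site k → ℝ)).Finite by simp, fun _ _ => rfl⟩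
  add_mem' {u v} hu hv := ⟨(hu.1.union hv.1).subset (Function.support_add u.1 v.1), fun x hx =>
    show u.1 x + v.1 x = 0 by rw [hu.2 x hx, hv.2 x hx, add_zero]⟩
  smul_mem' c u hu := ⟨hu.1.subset (Function.support_const_smul_subset c u.1), fun x hx =>
    show c * u.1 x = 0 by rw [hu.2 x hx, mul_zero]⟩

theorem coe_H0Submodule_univ : (H0Submodule R univ : Set (HDot R)) = Hc R := by
  ext v
  exact ⟨fun hv => hv.1, fun hv => ⟨hv, fun x hx => (hx (mem_univ x)).elim⟩⟩

theorem finiteDimensional_H0Submodule {Ω : Set (Site k)} (hΩ : Ω.Finite) :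
    FiniteDimensional ℝ (H0Submodule R Ω) := by
  have := hΩ.to_subtype
  let restrict : H0Submodule R Ω →ₗ[ℝ] Ω → ℝ :=
    { toFun := fun v x => v.1 x
      map_add' := fun _ _ => rfl
      map_smul' := fun _ _ => rfl }
  refine .of_injective restrict fun v w hvw => Subtype.ext (Subtype.ext (funext fun x => ?_))
  by_cases hx : x ∈ Ω
  · exact congrFun hvw ⟨x, hx⟩
  · exact (v.2.2 x hx).trans (w.2.2 x hx).symm

theorem add_smul_mem_closure_Hc {u v : HDot R} (hu : u ∈ closure (Hc R)) (hv : v ∈ Hc R) (t : ℝ) :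
    u + t • v ∈ closure (Hc R) := by
  rw [← coe_H0Submodule_univ] at hu hv ⊢
  exact (H0Submodule R univ).topologicalClosure.add_mem hu
    ((H0Submodule R univ).topologicalClosure.smul_mem t (subset_closure hv))

variable {V : EuclideanSpace ℝ R → ℝ} {V' : EuclideanSpace ℝ R → EuclideanSpace ℝ R →L[ℝ] ℝ}
  {V'' : EuclideanSpace ℝ R → EuclideanSpace ℝ R →L[ℝ] EuclideanSpace ℝ R →L[ℝ] ℝ} {M : ℝ≥0}
  {uPred : Site k → ℝ}

theorem energyC_eq_add_superposition (hV : TaylorBounds V V' V'' M) {v : HDot R} (hv : v ∈ Hc R) :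
    energyC R V uPred v = ∑' x, V' (grad R uPred x) (grad R v x)
      + superposition V V' (grad R uPred) (gradL R v) := by
  have hlin := (summable_clm_grad (fun x => V' (grad R uPred x)) hv).hasSum
  rw [← (hlin.add (superposition_hasSum hV _ _)).tsum_eq]
  exact tsum_congr fun x => (add_sub_cancel _ _).symm

theorem exists_taylorBounds_energy (hV : TaylorBounds V V' V'' M)
    (hforce : ∃ L : HDot R →L[ℝ] ℝ,
      ∀ v ∈ Hc R, L v = ∑' x, V' (grad R uPred x) (grad R v x)) :
    ∃ E E' E'', TaylorBounds E E' E'' M ∧ EqOn (energy R V uPred) E (closure (Hc R)) := by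
  obtain ⟨L, hL⟩ := hforce
  have hE := ((taylorBounds_superposition hV (grad R uPred)).comp_linearIsometry
    (Y := HDot R) ⟨gradL R, fun _ => rfl⟩).add_continuousLinearMap L
  refine ⟨_, _, _, hE, fun u hu => extendFrom_eq hu ?_⟩
  refine ((hE.continuous.tendsto u).mono_left nhdsWithin_le_nhds).congr' ?_
  filter_upwards [self_mem_nhdsWithin] with v hv
  rw [energyC_eq_add_superposition hV hv, ← hL v hv]
  rfl

variable {F E : HDot R → ℝ} {E' : HDot R → HDot R →L[ℝ] ℝ}
  {E'' : HDot R → HDot R →L[ℝ] HDot R →L[ℝ] ℝ} {u v : HDot R}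

theorem secondVariation_eq (hE : TaylorBounds E E' E'' M) (hFE : EqOn F E (closure (Hc R)))
    (hu : u ∈ closure (Hc R)) (hv : v ∈ Hc R) : secondVariation F u v = E'' u v v := by
  rw [secondVariation, ← hE.iteratedDeriv_two_line]
  exact congrArg (iteratedDeriv 2 · 0) (funext fun t => hFE (add_smul_mem_closure_Hc hu hv t))

theorem deriv_eq_zero_of_isLocalMin (hE : TaylorBounds E E' E'' M)
    (hFE : EqOn F E (closure (Hc R))) (hu : u ∈ closure (Hc R)) (hmin : IsLocalMin F u)
    (hv : v ∈ Hc R) : E' u v = 0 := by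
  have hline : Tendsto (fun t : ℝ => u + t • v) (𝓝 0) (𝓝 u) :=
    Continuous.tendsto' (by fun_prop) _ _ (by simp)
  have hmin' : IsLocalMin (fun t : ℝ => E (u + t • v)) 0 := by
    filter_upwards [hline.eventually hmin] with t ht
    rwa [zero_smul, add_zero, ← hFE hu, ← hFE (add_smul_mem_closure_Hc hu hv t)]
  simpa using hmin'.hasDerivAt_eq_zero (hE.hasDerivAt_line u v 0)

theorem exists_supercell_solution (hE : TaylorBounds E E' E'' M)
    (hFE : EqOn F E (closure (Hc R))) (hu : u ∈ closure (Hc R)) (hmin : IsLocalMin F u) {c : ℝ}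
    (hc : 0 < c) (hstab : ∀ v ∈ Hc R, c * ‖v‖ ^ 2 ≤ secondVariation F u v) {Ω : Set (Site k)}
    (hΩ : Ω.Finite) {a : HDot R} (ha : a ∈ H0 R Ω) {η : ℝ} (hη : 0 < η) (hau : ‖a - u‖ ≤ η)
    (hsmall : M * ((8 * M / c + 2) * η) ≤ c / 8) :
    ∃ m ∈ H0 R Ω, IsLocalMinOn F (H0 R Ω) m ∧
      (∀ v ∈ H0 R Ω, c / 2 * ‖v‖ ^ 2 ≤ secondVariation F m v) ∧
      ‖m - u‖ ≤ (8 * M / c + 2) * η := by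
  have := finiteDimensional_H0Submodule (R := R) hΩ
  obtain ⟨m, hm, hmmin, hmstab, hmu⟩ := hE.exists_isLocalMinOn_of_near (W := H0Submodule R Ω) hc hη
    (fun v hv => deriv_eq_zero_of_isLocalMin hE hFE hu hmin hv.1)
    (fun v hv => (hstab v hv.1).trans_eq (secondVariation_eq hE hFE hu hv.1)) ha hau hsmall
  refine ⟨m, hm, ?_, fun v hv => ?_, hmu⟩
  · filter_upwards [hmmin, self_mem_nhdsWithin] with v hv hvΩ
    rwa [hFE (subset_closure hm.1), hFE (subset_closure hvΩ.1)]
  · rw [secondVariation_eq hE hFE (subset_closure hm.1) hv.1]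
    exact hmstab v hv

end Energy

/-! ### Lattice geometry -/

theorem LatticeKind.tau_im_pos (k : LatticeKind) : 0 < k.tau.im := by
  cases k <;> simp [LatticeKind.tau]

theorem LatticeKind.norm_tau (k : LatticeKind) : ‖k.tau‖ = 1 := by
  rw [← sq_eq_sq₀ (norm_nonneg _) zero_le_one, Complex.sq_norm, Complex.normSq_apply]
  cases k
  · simp [LatticeKind.tau]
  · have := Real.mul_self_sqrt (show (0 : ℝ) ≤ 3 by norm_num)
    simp only [LatticeKind.tau]
    linarith

/-- Lattice coordinates with respect to the basis `1`, `tau`. -/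
def siteEquiv (k : LatticeKind) : ℤ × ℤ ≃+ Site k :=
  AddEquiv.ofBijective
    (AddMonoidHom.mk' (fun p : ℤ × ℤ => (⟨p.1 + p.2 * k.tau, p.1, p.2, rfl⟩ : Site k))
      fun p q => Subtype.ext (by
        simp only [Prod.fst_add, Prod.snd_add, Int.cast_add, AddSubgroup.coe_add]; ring))
    ⟨by
      refine (injective_iff_map_eq_zero _).2 fun p hp => ?_
      have hp : (p.1 : ℂ) + p.2 * k.tau = 0 := congrArg Subtype.val hp
      have him : p.2 = 0 := by simpa [k.tau_im_pos.ne'] using congrArg Complex.im hp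
      have hre : p.1 = 0 := by simpa [him] using hp
      exact Prod.ext hre him, by
      rintro ⟨_, m, n, rfl⟩
      exact ⟨(m, n), rfl⟩⟩

theorem coe_siteEquiv (p : ℤ × ℤ) : (siteEquiv k p : ℂ) = p.1 + p.2 * k.tau := rfl

theorem norm_siteEquiv_le (p : ℤ × ℤ) : ‖(siteEquiv k p : ℂ)‖ ≤ 2 * ‖p‖ := by
  calc ‖(p.1 : ℂ) + p.2 * k.tau‖ ≤ ‖(p.1 : ℂ)‖ + ‖p.2 * k.tau‖ := norm_add_le _ _
    _ = ‖p.1‖ + ‖p.2‖ := by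
      rw [norm_mul, k.norm_tau, mul_one, Complex.norm_intCast, Complex.norm_intCast,
        Int.norm_eq_abs, Int.norm_eq_abs]
    _ ≤ 2 * ‖p‖ := by linarith [norm_fst_le p, norm_snd_le p]

theorem norm_le_siteEquiv (p : ℤ × ℤ) : ‖p‖ ≤ 2 * ‖(siteEquiv k p : ℂ)‖ := by
  have hsq : (p.1 : ℝ) ^ 2 ≤ (2 * ‖(siteEquiv k p : ℂ)‖) ^ 2 ∧
      (p.2 : ℝ) ^ 2 ≤ (2 * ‖(siteEquiv k p : ℂ)‖) ^ 2 := by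
    have h3 := Real.sq_sqrt (show (0 : ℝ) ≤ 3 by norm_num)
    rw [mul_pow, Complex.sq_norm, Complex.normSq_apply, coe_siteEquiv]
    cases k <;> simp [LatticeKind.tau] <;> constructor <;>
      nlinarith [sq_nonneg (p.1 : ℝ), sq_nonneg (p.2 : ℝ), sq_nonneg ((p.1 : ℝ) + 2 * p.2),
        sq_nonneg (2 * (p.1 : ℝ) + p.2)]
  rw [Prod.norm_def, Int.norm_eq_abs, Int.norm_eq_abs]
  exact max_le (abs_le_of_sq_le_sq hsq.1 (by positivity))
    (abs_le_of_sq_le_sq hsq.2 (by positivity))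

theorem norm_siteEquiv_symm_le (x : Site k) : ‖(siteEquiv k).symm x‖ ≤ 2 * ‖(x : ℂ)‖ := by
  simpa using norm_le_siteEquiv (k := k) ((siteEquiv k).symm x)

theorem norm_le_siteEquiv_symm (x : Site k) : ‖(x : ℂ)‖ ≤ 2 * ‖(siteEquiv k).symm x‖ := by
  simpa using norm_siteEquiv_le (k := k) ((siteEquiv k).symm x)

theorem tendsto_norm_cofinite (k : LatticeKind) :
    Tendsto (fun x : Site k => ‖(x : ℂ)‖) cofinite atTop := by
  have hcoord : Tendsto (fun x : Site k => ‖(siteEquiv k).symm x‖) cofinite atTop := by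
    have := tendsto_norm_cocompact_atTop (E := ℤ × ℤ)
    rw [cocompact_eq_cofinite] at this
    exact this.comp (siteEquiv k).symm.injective.tendsto_cofinite
  exact tendsto_atTop_mono (fun x => by linarith [norm_siteEquiv_symm_le x])
    (hcoord.atTop_div_const two_pos)

theorem finite_norm_lt (k : LatticeKind) (b : ℝ) : {x : Site k | ‖(x : ℂ)‖ < b}.Finite := by
  simpa using (tendsto_norm_cofinite k).eventually_ge_atTop b

theorem card_le_of_norm_le {b : ℝ} (hb : 1 ≤ b) {S : Finset (Site k)}
    (hS : ∀ x ∈ S, ‖(x : ℂ)‖ ≤ b) : (S.card : ℝ) ≤ 25 * b ^ 2 := by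
  set n := ⌊2 * b⌋₊
  have hmaps : ∀ x ∈ S, (siteEquiv k).symm x ∈
      Finset.Icc (-(n : ℤ)) n ×ˢ Finset.Icc (-(n : ℤ)) n := fun x hx => by
    have hcoord := (norm_siteEquiv_symm_le x).trans (mul_le_mul_of_nonneg_left (hS x hx) two_pos.le)
    rw [Prod.norm_def, max_le_iff, Int.norm_eq_abs, Int.norm_eq_abs, ← Int.cast_abs,
      ← Int.cast_abs, ← Nat.cast_natAbs, ← Nat.cast_natAbs] at hcoord
    have h₁ := Nat.le_floor hcoord.1
    have h₂ := Nat.le_floor hcoord.2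
    simp only [Finset.mem_product, Finset.mem_Icc]
    omega
  have hcard := Finset.card_le_card_of_injOn _ hmaps (siteEquiv k).symm.injective.injOn
  rw [Finset.card_product, Int.card_Icc, show ((n : ℤ) + 1 - -n).toNat = 2 * n + 1 by omega]
    at hcard
  have hn : (n : ℝ) ≤ 2 * b := Nat.floor_le (by positivity)
  calc (S.card : ℝ) ≤ (2 * n + 1) * (2 * n + 1) := by exact_mod_cast hcard
    _ ≤ (5 * b) * (5 * b) := by gcongr <;> linarith
    _ = 25 * b ^ 2 := by ring

theorem discreteTopology_lattice (k : LatticeKind) :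
    DiscreteTopology (AddSubgroup.toIntSubmodule (lattice k)) := by
  refine .of_forall_le_norm (r := 1 / 2) (by norm_num) fun x hx => ?_
  have hne : (siteEquiv k).symm x ≠ 0 := fun h => hx ((siteEquiv k).symm.map_eq_zero_iff.1 h)
  have hone : 1 ≤ ‖(siteEquiv k).symm x‖ := by
    generalize (siteEquiv k).symm x = p at hne
    have hmn : p.1 ≠ 0 ∨ p.2 ≠ 0 := by
      contrapose! hne
      exact Prod.ext hne.1 hne.2
    rw [Prod.norm_def, le_max_iff, Int.norm_eq_abs, Int.norm_eq_abs]
    exact hmn.imp (fun h => by exact_mod_cast Int.one_le_abs h)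
      fun h => by exact_mod_cast Int.one_le_abs h
  change 1 / 2 ≤ ‖(x : ℂ)‖
  linarith [norm_siteEquiv_symm_le (k := k) x]

theorem summable_norm_rpow {α : ℝ} (hα : 2 < α) :
    Summable fun x : Site k => ‖(x : ℂ)‖ ^ (-α) := by
  have := discreteTopology_lattice k
  refine ZLattice.summable_norm_rpow (AddSubgroup.toIntSubmodule (lattice k)) (-α) ?_
  have hrank : Module.finrank ℤ (AddSubgroup.toIntSubmodule (lattice k)) = 2 := by
    have := (siteEquiv k).toIntLinearEquiv.finrank_eq
    rwa [Module.finrank_prod, Module.finrank_self, eq_comm] at this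
  rw [hrank]
  push_cast
  linarith

theorem sum_norm_div_rpow_le_of_mem_shell {α T : ℝ} (hα : 0 ≤ α) (hT : 1 ≤ T) (n : ℕ)
    {S : Finset (Site k)}
    (hS : ∀ x ∈ S, 2 ^ n ≤ ‖(x : ℂ)‖ / T ∧ ‖(x : ℂ)‖ ≤ 2 ^ (n + 1) * T) :
    ∑ x ∈ S, (‖(x : ℂ)‖ / T) ^ (-α) ≤ 100 * T ^ 2 * (4 * 2 ^ (-α)) ^ n := by
  have hterm : ∀ x ∈ S, (‖(x : ℂ)‖ / T) ^ (-α) ≤ (2 ^ (-α)) ^ n := fun x hx =>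
    calc (‖(x : ℂ)‖ / T) ^ (-α) ≤ ((2 : ℝ) ^ n) ^ (-α) :=
          Real.rpow_le_rpow_of_nonpos (by positivity) (hS x hx).1 (by linarith)
      _ = (2 ^ (-α)) ^ n := by rw [Real.rpow_pow_comm two_pos.le]
  have hcard : (S.card : ℝ) ≤ 25 * (2 ^ (n + 1) * T) ^ 2 :=
    card_le_of_norm_le (one_le_mul_of_one_le_of_one_le (one_le_pow₀ one_le_two) hT)
      fun x hx => (hS x hx).2
  calc _ ≤ S.card • ((2 : ℝ) ^ (-α)) ^ n := Finset.sum_le_card_nsmul _ _ _ hterm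
    _ ≤ 25 * (2 ^ (n + 1) * T) ^ 2 * ((2 : ℝ) ^ (-α)) ^ n := by
        rw [nsmul_eq_mul]; gcongr
    _ = 100 * T ^ 2 * (4 * 2 ^ (-α)) ^ n := by
        have h4 : (4 : ℝ) ^ n = (2 ^ n) ^ 2 := by rw [← pow_mul, mul_comm, pow_mul]; norm_num
        rw [mul_pow 4, h4]
        ring

/-- The contributions of the dyadic shells `2 ^ n T ≤ ‖x‖ < 2 ^ (n + 1) T` form a geometric
series. -/
theorem exists_sum_norm_div_rpow_le {α : ℝ} (hα : 2 < α) :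
    ∃ C, 0 < C ∧ ∀ T, 1 ≤ T → ∀ S : Finset (Site k), (∀ x ∈ S, T ≤ ‖(x : ℂ)‖) →
      ∑ x ∈ S, (‖(x : ℂ)‖ / T) ^ (-α) ≤ C * T ^ 2 := by
  set q : ℝ := 4 * 2 ^ (-α) with hq
  have hq0 : 0 < q := by positivity
  have hq1 : q < 1 := by
    have : (2 : ℝ) ^ (-α) < 2 ^ (-2 : ℝ) :=
      Real.rpow_lt_rpow_of_exponent_lt one_lt_two (by linarith)
    rw [hq]
    norm_num [Real.rpow_neg] at this ⊢
    linarith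
  refine ⟨100 * (1 - q)⁻¹, by have := sub_pos.2 hq1; positivity, fun T hT S hS => ?_⟩
  have hT0 : 0 < T := by linarith
  let shell : Site k → ℕ := fun x => Nat.log 2 ⌊‖(x : ℂ)‖ / T⌋₊
  have hshell : ∀ x ∈ S, 2 ^ shell x ≤ ‖(x : ℂ)‖ / T ∧ ‖(x : ℂ)‖ ≤ 2 ^ (shell x + 1) * T := by
    intro x hx
    have hx1 : 1 ≤ ‖(x : ℂ)‖ / T := (one_le_div hT0).2 (hS x hx)
    have hfloor : ⌊‖(x : ℂ)‖ / T⌋₊ ≠ 0 := (Nat.floor_pos.2 hx1).ne'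
    refine ⟨?_, ?_⟩
    · exact_mod_cast (Nat.le_floor_iff (by positivity)).1 (Nat.pow_log_le_self 2 hfloor)
    · rw [← div_le_iff₀ hT0]
      exact_mod_cast ((Nat.floor_lt (by positivity)).1 (Nat.lt_pow_succ_log_self one_lt_two _)).le
  have hfiber : ∀ n, ∑ x ∈ S with shell x = n, (‖(x : ℂ)‖ / T) ^ (-α) ≤ 100 * T ^ 2 * q ^ n :=
    fun n => sum_norm_div_rpow_le_of_mem_shell (by linarith) hT n fun x hx => by
      obtain ⟨hxS, rfl⟩ := Finset.mem_filter.1 hx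
      exact hshell x hxS
  calc _ = ∑ n ∈ S.image shell, ∑ x ∈ S with shell x = n, (‖(x : ℂ)‖ / T) ^ (-α) :=
        (Finset.sum_fiberwise_of_maps_to (fun x hx => Finset.mem_image_of_mem _ hx) _).symm
    _ ≤ ∑ n ∈ S.image shell, 100 * T ^ 2 * q ^ n := Finset.sum_le_sum fun n _ => hfiber n
    _ = 100 * T ^ 2 * ∑ n ∈ S.image shell, q ^ n := (Finset.mul_sum _ _ _).symm
    _ ≤ 100 * T ^ 2 * (1 - q)⁻¹ := by
        rw [← tsum_geometric_of_lt_one hq0.le hq1]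
        gcongr
        exact (summable_geometric_of_lt_one hq0.le hq1).sum_le_tsum _ fun _ _ => by positivity
    _ = 100 * (1 - q)⁻¹ * T ^ 2 := by ring

section Directions

variable {R : Finset (Site k)}

theorem abs_sub_le_norm_grad {e : Site k} (he : e ∈ R) (u : Site k → ℝ) (x : Site k) :
    |u (x + e) - u x| ≤ ‖grad R u x‖ :=
  PiLp.norm_apply_le (grad R u x) ⟨e, he⟩

theorem exists_abs_sub_le_sum_norm_grad (hR : AddSubgroup.closure (R : Set (Site k)) = ⊤)
    (e : Site k) : ∃ (ι : Type) (_ : Fintype ι) (y : ι → Site k), ∀ (u : Site k → ℝ) (x : Site k),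
      |u (x + e) - u x| ≤ ∑ i, ‖grad R u (x + y i)‖ := by
  have he : e ∈ AddSubgroup.closure (R : Set (Site k)) := hR ▸ AddSubgroup.mem_top e
  induction he using AddSubgroup.closure_induction with
  | mem e he =>
    exact ⟨Unit, inferInstance, fun _ => 0, fun u x => by simpa using abs_sub_le_norm_grad he u x⟩
  | zero => exact ⟨Empty, inferInstance, fun _ => 0, fun u x => by simp⟩
  | add e f _ _ ihe ihf =>
    obtain ⟨ι, _, y, hy⟩ := ihe
    obtain ⟨κ, _, z, hz⟩ := ihf
    refine ⟨ι ⊕ κ, inferInstance, Sum.elim y fun i => e + z i, fun u x => ?_⟩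
    have hpath : u (x + (e + f)) - u x = (u (x + e) - u x) + (u (x + e + f) - u (x + e)) := by
      rw [add_assoc]; ring
    rw [hpath, Fintype.sum_sum_type]
    simpa [add_assoc] using (abs_add_le _ _).trans (add_le_add (hy u x) (hz u (x + e)))
  | neg e _ ih =>
    obtain ⟨ι, _, y, hy⟩ := ih
    refine ⟨ι, inferInstance, fun i => -e + y i, fun u x => ?_⟩
    have := hy u (x + -e)
    rw [neg_add_cancel_right, abs_sub_comm] at this
    simpa only [add_assoc] using this

theorem exists_abs_sub_le_of_norm_grad_le (hR : AddSubgroup.closure (R : Set (Site k)) = ⊤)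
    (e : Site k) : ∃ C K : ℝ, 0 ≤ C ∧ ∀ (u : Site k → ℝ) (T B : ℝ),
      (∀ x : Site k, T ≤ ‖(x : ℂ)‖ → ‖grad R u x‖ ≤ B) →
      ∀ x : Site k, T + K ≤ ‖(x : ℂ)‖ → |u (x + e) - u x| ≤ C * B := by
  obtain ⟨ι, _, y, hy⟩ := exists_abs_sub_le_sum_norm_grad hR e
  refine ⟨Fintype.card ι, ∑ i, ‖(y i : ℂ)‖, by positivity, fun u T B hB x hx => (hy u x).trans ?_⟩
  rw [← nsmul_eq_mul, ← Finset.card_univ]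
  refine Finset.sum_le_card_nsmul _ _ _ fun i _ => hB _ ?_
  have hi := Finset.single_le_sum (f := fun i => ‖(y i : ℂ)‖) (fun _ _ => norm_nonneg _)
    (Finset.mem_univ i)
  have := norm_sub_norm_le (x : ℂ) (-(y i : ℂ))
  rw [norm_neg, sub_neg_eq_add] at this
  push_cast
  linarith

theorem hasSum_norm_grad_sq (v : HDot R) : HasSum (fun x => ‖grad R v x‖ ^ 2) (‖v‖ ^ 2) := by
  have hsum := (summable_norm_sq (gradL R v)).hasSum
  rw [tsum_norm_sq (gradL R v)] at hsum
  exact hsum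

theorem exists_tsum_sub_sq_le (hR : AddSubgroup.closure (R : Set (Site k)) = ⊤) (e : Site k) :
    ∃ C : ℝ, 0 ≤ C ∧ ∀ v : HDot R, Summable (fun x => (v (x + e) - v x) ^ 2) ∧
      ∑' x, (v (x + e) - v x) ^ 2 ≤ C * ‖v‖ ^ 2 := by
  obtain ⟨ι, _, y, hy⟩ := exists_abs_sub_le_sum_norm_grad hR e
  refine ⟨Fintype.card ι * Fintype.card ι, by positivity, fun v => ?_⟩
  have hshift : ∀ i, HasSum (fun x => ‖grad R v (x + y i)‖ ^ 2) (‖v‖ ^ 2) := fun i =>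
    ((Equiv.addRight (y i)).hasSum_iff (f := fun x => ‖grad R v x‖ ^ 2)).2 (hasSum_norm_grad_sq v)
  have hsum : HasSum (fun x => Fintype.card ι * ∑ i, ‖grad R v (x + y i)‖ ^ 2)
      (Fintype.card ι * ∑ _i : ι, ‖v‖ ^ 2) :=
    (hasSum_sum fun i _ => hshift i).mul_left (Fintype.card ι : ℝ)
  have hle : ∀ x, (v (x + e) - v x) ^ 2 ≤ Fintype.card ι * ∑ i, ‖grad R v (x + y i)‖ ^ 2 := by
    intro x
    rw [← sq_abs, ← Finset.card_univ]
    exact (pow_le_pow_left₀ (abs_nonneg _) (hy v.1 x) 2).trans sq_sum_le_card_mul_sum_sq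
  have hsummable := hsum.summable.of_nonneg_of_le (fun _ => sq_nonneg _) hle
  refine ⟨hsummable, (hasSum_le hle hsummable.hasSum hsum).trans_eq ?_⟩
  rw [Finset.sum_const, Finset.card_univ, nsmul_eq_mul, mul_assoc]

end Directions

/-! ### Truncation -/

/-- The rate `J ^ (1 - s) (log J) ^ r` of the supercell error. -/
def truncRate (s : ℝ) (r : ℕ) (J : ℝ) : ℝ := J ^ (1 - s) * Real.log J ^ r

theorem truncRate_pos (s : ℝ) (r : ℕ) {J : ℝ} (hJ : 1 < J) : 0 < truncRate s r J :=
  mul_pos (Real.rpow_pos_of_pos (by linarith) _) (pow_pos (Real.log_pos hJ) r)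

theorem tendsto_truncRate {s : ℝ} (hs : 1 < s) (r : ℕ) :
    Tendsto (truncRate s r) atTop (𝓝 0) := by
  refine ((isLittleO_log_rpow_rpow_atTop (r : ℝ) (sub_pos.2 hs)).tendsto_div_nhds_zero).congr' ?_
  filter_upwards [eventually_gt_atTop 0] with J hJ
  rw [truncRate, Real.rpow_natCast, ← neg_sub s, Real.rpow_neg hJ.le, div_eq_inv_mul]

theorem truncRate_div_le {s : ℝ} (r : ℕ) {a J : ℝ} (ha : 1 ≤ a) (hJ : a < J) :
    truncRate s r (J / a) ≤ a ^ (s - 1) * truncRate s r J := by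
  have ha0 : 0 < a := by linarith
  have hJa : 1 < J / a := (one_lt_div ha0).2 hJ
  have hlog : Real.log (J / a) ≤ Real.log J :=
    Real.log_le_log (by linarith) (div_le_self (by linarith) ha)
  have hlog0 := Real.log_nonneg hJa.le
  rw [truncRate, truncRate, Real.div_rpow (by linarith) ha0.le, ← neg_sub s, Real.rpow_neg ha0.le,
    div_inv_eq_mul, mul_comm _ (a ^ (s - 1)), mul_assoc]
  have : 0 ≤ J ^ (-(s - 1)) := Real.rpow_nonneg (by linarith) _
  gcongr

theorem exists_log_mul_pow_le {δ : ℝ} (hδ : 0 < δ) (r : ℕ) : ∃ C, 0 < C ∧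
    ∀ T t, Real.exp 1 ≤ T → 1 ≤ t → Real.log (T * t) ^ r ≤ C * (Real.log T ^ r * t ^ δ) := by
  set ε := δ / (r + 1) with hε
  have hε0 : 0 < ε := by positivity
  refine ⟨(1 + 1 / ε) ^ r, by positivity, fun T t hT ht => ?_⟩
  have hT0 : 0 < T := (Real.exp_pos 1).trans_le hT
  have hlogT : 1 ≤ Real.log T := (Real.le_log_iff_exp_le hT0).2 hT
  have hlogt := Real.log_nonneg ht
  have htε : 1 ≤ t ^ ε := Real.one_le_rpow ht hε0.le
  have hadd : Real.log (T * t) ≤ Real.log T * ((1 + 1 / ε) * t ^ ε) := by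
    have hlog : Real.log t ≤ 1 / ε * t ^ ε :=
      (Real.log_le_rpow_div (by linarith) hε0).trans_eq (by ring)
    rw [Real.log_mul hT0.ne' (by linarith)]
    nlinarith
  calc Real.log (T * t) ^ r ≤ (Real.log T * ((1 + 1 / ε) * t ^ ε)) ^ r := by
        rw [Real.log_mul hT0.ne' (by linarith)] at hadd ⊢
        gcongr
    _ = (1 + 1 / ε) ^ r * (Real.log T ^ r * t ^ (ε * r)) := by
        rw [Real.rpow_mul_natCast (by linarith), mul_pow, mul_pow]; ring
    _ ≤ (1 + 1 / ε) ^ r * (Real.log T ^ r * t ^ δ) := by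
        have hεr : ε * r ≤ δ := by
          rw [hε, div_mul_eq_mul_div, div_le_iff₀ (by positivity)]
          nlinarith
        gcongr

theorem exists_rpow_mul_log_pow_le {s : ℝ} (hs : 1 < s) (r : ℕ) : ∃ C, 0 < C ∧
    ∀ T t, Real.exp 1 ≤ T → T ≤ t →
      t ^ (-s) * Real.log t ^ r ≤ C * (truncRate s r T / T) * (t / T) ^ (-((s + 1) / 2)) := by
  obtain ⟨C, hC, hlog⟩ := exists_log_mul_pow_le (half_pos (sub_pos.2 hs)) r
  refine ⟨C, hC, fun T t hT hTt => ?_⟩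
  have hT0 : 0 < T := (Real.exp_pos 1).trans_le hT
  obtain ⟨τ, rfl⟩ : ∃ τ, t = T * τ := ⟨t / T, by field_simp⟩
  have hτ : 1 ≤ τ := by nlinarith
  have hτ0 : 0 < τ := by linarith
  rw [mul_div_cancel_left₀ _ hT0.ne', Real.mul_rpow hT0.le hτ0.le]
  calc T ^ (-s) * τ ^ (-s) * Real.log (T * τ) ^ r
      ≤ T ^ (-s) * τ ^ (-s) * (C * (Real.log T ^ r * τ ^ ((s - 1) / 2))) := by
        gcongr
        exact hlog T τ hT hτ
    _ = C * (T ^ (-s) * Real.log T ^ r) * (τ ^ (-s) * τ ^ ((s - 1) / 2)) := by ring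
    _ = C * (truncRate s r T / T) * τ ^ (-((s + 1) / 2)) := by
        rw [← Real.rpow_add hτ0, truncRate, mul_div_right_comm, ← Real.rpow_sub_one hT0.ne']
        ring_nf

theorem abs_sub_le_of_abs_succ_sub_le {f : ℤ → ℝ} {B : ℝ} (h : ∀ j, |f (j + 1) - f j| ≤ B)
    (i j : ℤ) : |f i - f j| ≤ |(i : ℝ) - j| * B := by
  wlog hij : j ≤ i generalizing i j
  · rw [abs_sub_comm, abs_sub_comm (i : ℝ)]
    exact this j i (not_le.1 hij).le
  induction i, hij using Int.leInduction with
  | base => simp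
  | succ i hij ih =>
    have hij' : (j : ℝ) ≤ i := by exact_mod_cast hij
    rw [abs_of_nonneg (sub_nonneg.2 hij')] at ih
    rw [abs_of_nonneg (a := ((i + 1 : ℤ) : ℝ) - j) (by push_cast; linarith)]
    calc |f (i + 1) - f j| ≤ |f (i + 1) - f i| + |f i - f j| := abs_sub_le _ _ _
      _ ≤ B + (i - j) * B := add_le_add (h i) ih
      _ = (((i + 1 : ℤ) : ℝ) - j) * B := by push_cast; ring

/-- Any point outside the open square of radius `a` is joined to the diagonal point `(m, m)` by
two axis-parallel segments outside that square. -/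
theorem abs_sub_le_of_norm_mem_Icc {f : ℤ × ℤ → ℝ} {a b B : ℝ} {m : ℤ} (hm : ‖m‖ ∈ Icc a b)
    (h₁ : ∀ p, a ≤ ‖p‖ → |f (p + (1, 0)) - f p| ≤ B)
    (h₂ : ∀ p, a ≤ ‖p‖ → |f (p + (0, 1)) - f p| ≤ B) {p : ℤ × ℤ} (hp : ‖p‖ ∈ Icc a b) :
    |f p - f (m, m)| ≤ 4 * b * B := by
  obtain ⟨i, j⟩ := p
  have hB : 0 ≤ B := (abs_nonneg _).trans (h₁ _ hp.1)
  have hrow : ∀ j : ℤ, a ≤ ‖j‖ → ∀ i i', |f (i, j) - f (i', j)| ≤ |(i : ℝ) - i'| * B :=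
    fun j hj => abs_sub_le_of_abs_succ_sub_le fun i => by
      simpa using h₁ (i, j) (hj.trans (norm_snd_le (i, j)))
  have hcol : ∀ i : ℤ, a ≤ ‖i‖ → ∀ j j', |f (i, j) - f (i, j')| ≤ |(j : ℝ) - j'| * B :=
    fun i hi => abs_sub_le_of_abs_succ_sub_le fun j => by
      simpa using h₂ (i, j) (hi.trans (norm_fst_le (i, j)))
  have hdist : ∀ i : ℤ, ‖i‖ ≤ b → |(i : ℝ) - m| ≤ 2 * b := fun i hi => by
    have := norm_sub_le (i : ℝ) m
    rw [Int.norm_cast_real, Int.norm_cast_real] at this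
    linarith [hm.2, Real.norm_eq_abs ((i : ℝ) - m)]
  have hi := hdist i ((norm_fst_le (i, j)).trans hp.2)
  have hj := hdist j ((norm_snd_le (i, j)).trans hp.2)
  have htotal : (|(i : ℝ) - m| + |(j : ℝ) - m|) * B ≤ 4 * b * B := by gcongr; linarith
  refine le_trans ?_ htotal
  rcases le_max_iff.1 hp.1 with ha | ha
  · linarith [abs_sub_le (f (i, j)) (f (i, m)) (f (m, m)), hcol i ha j m, hrow m hm.1 i m]
  · linarith [abs_sub_le (f (i, j)) (f (m, j)) (f (m, m)), hrow j ha i m, hcol m hm.1 j m]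

/-- A Lipschitz cutoff: `1` on the ball of radius `J` and `0` outside that of radius `2 J`. -/
def cutoff (J : ℝ) (x : Site k) : ℝ := max (min (2 - ‖(x : ℂ)‖ / J) 1) 0

theorem cutoff_nonneg (J : ℝ) (x : Site k) : 0 ≤ cutoff J x := le_max_right _ _

theorem cutoff_le_one (J : ℝ) (x : Site k) : cutoff J x ≤ 1 :=
  max_le (min_le_right _ _) zero_le_one

theorem cutoff_eq_one {J : ℝ} (hJ : 0 < J) {x : Site k} (hx : ‖(x : ℂ)‖ ≤ J) :
    cutoff J x = 1 := by
  have := (div_le_one hJ).2 hx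
  rw [cutoff, min_eq_right (by linarith), max_eq_left zero_le_one]

theorem cutoff_eq_zero {J : ℝ} (hJ : 0 < J) {x : Site k} (hx : 2 * J ≤ ‖(x : ℂ)‖) :
    cutoff J x = 0 := by
  have := (le_div_iff₀ hJ).2 hx
  exact max_eq_right ((min_le_left _ _).trans (by linarith))

theorem abs_cutoff_add_sub_le {J : ℝ} (hJ : 0 < J) (x e : Site k) :
    |cutoff J (x + e) - cutoff J x| ≤ ‖(e : ℂ)‖ / J := by
  calc |cutoff J (x + e) - cutoff J x|
      ≤ |min (2 - ‖((x + e : Site k) : ℂ)‖ / J) 1 - min (2 - ‖(x : ℂ)‖ / J) 1| :=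
        abs_max_sub_max_le_abs _ _ _
    _ ≤ |2 - ‖((x + e : Site k) : ℂ)‖ / J - (2 - ‖(x : ℂ)‖ / J)| := by
        simpa using abs_min_sub_min_le_max (2 - ‖((x + e : Site k) : ℂ)‖ / J) 1
          (2 - ‖(x : ℂ)‖ / J) 1
    _ = |‖((x + e : Site k) : ℂ)‖ - ‖(x : ℂ)‖| / J := by
        rw [sub_sub_sub_cancel_left, ← sub_div, abs_div, abs_of_pos hJ, abs_sub_comm]
    _ ≤ ‖(e : ℂ)‖ / J := by
        gcongr
        simpa using abs_norm_sub_norm_le ((x : ℂ) + e) x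

section Truncation

variable {R : Finset (Site k)}

theorem norm_sq_grad (u : Site k → ℝ) (x : Site k) :
    ‖grad R u x‖ ^ 2 = ∑ ρ : R, (u (x + ρ) - u x) ^ 2 := by
  simp [EuclideanSpace.norm_sq_eq, grad]

theorem norm_sq_grad_cutoff_le {J : ℝ} (hJ : 0 < J) (x : Site k) :
    ‖grad R (cutoff J) x‖ ^ 2 ≤ (∑ ρ : R, ‖(ρ : ℂ)‖ ^ 2) / J ^ 2 := by
  rw [norm_sq_grad, Finset.sum_div]
  refine Finset.sum_le_sum fun ρ _ => ?_
  rw [← div_pow]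
  exact sq_le_sq' (neg_le_of_abs_le (abs_cutoff_add_sub_le hJ x ρ))
    (le_of_abs_le (abs_cutoff_add_sub_le hJ x ρ))

theorem norm_sq_grad_truncation_le {χ : Site k → ℝ} (h0 : ∀ x, 0 ≤ χ x) (h1 : ∀ x, χ x ≤ 1)
    (u : Site k → ℝ) (a : ℝ) (x : Site k) :
    ‖grad R (fun y => χ y * (u y - a) - u y) x‖ ^ 2 ≤
      2 * ‖grad R u x‖ ^ 2 + 2 * ‖grad R χ x‖ ^ 2 * (u x - a) ^ 2 := by
  simp only [norm_sq_grad, Finset.mul_sum, Finset.sum_mul, ← Finset.sum_add_distrib]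
  refine Finset.sum_le_sum fun ρ _ => ?_
  have hprod : χ (x + ρ) * (u (x + ρ) - a) - u (x + ρ) - (χ x * (u x - a) - u x) =
      (χ (x + ρ) - 1) * (u (x + ρ) - u x) + (χ (x + ρ) - χ x) * (u x - a) := by ring
  have hχ : (χ (x + ρ) - 1) ^ 2 ≤ 1 := by nlinarith [h0 (x + ρ), h1 (x + ρ)]
  calc _ ≤ 2 * (((χ (x + ρ) - 1) * (u (x + ρ) - u x)) ^ 2 +
        ((χ (x + ρ) - χ x) * (u x - a)) ^ 2) := by rw [hprod]; exact add_sq_le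
    _ = 2 * ((χ (x + ρ) - 1) ^ 2 * (u (x + ρ) - u x) ^ 2) +
        2 * (χ (x + ρ) - χ x) ^ 2 * (u x - a) ^ 2 := by ring
    _ ≤ 2 * (u (x + ρ) - u x) ^ 2 + 2 * (χ (x + ρ) - χ x) ^ 2 * (u x - a) ^ 2 := by
        gcongr
        exact mul_le_of_le_one_left (sq_nonneg _) hχ

theorem grad_eq_zero_of_eq {f : Site k → ℝ} {c : ℝ} {x : Site k} (hx : f x = c)
    (hadd : ∀ ρ ∈ R, f (x + ρ) = c) : grad R f x = 0 := by
  ext ρ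
  simp [grad, hx, hadd ρ ρ.2]

theorem exists_abs_sub_le_of_norm_mem_annulus (hR : AddSubgroup.closure (R : Set (Site k)) = ⊤) :
    ∃ C K : ℝ, 0 < C ∧ ∀ (u : Site k → ℝ) (T B : ℝ), K ≤ T →
      (∀ x : Site k, T ≤ ‖(x : ℂ)‖ → ‖grad R u x‖ ≤ B) →
      ∃ a, ∀ x : Site k, 8 * T ≤ ‖(x : ℂ)‖ → ‖(x : ℂ)‖ ≤ 48 * T → |u x - a| ≤ C * (T * B) := by
  obtain ⟨C₁, K₁, hC₁, h₁⟩ := exists_abs_sub_le_of_norm_grad_le hR (siteEquiv k (1, 0))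
  obtain ⟨C₂, K₂, hC₂, h₂⟩ := exists_abs_sub_le_of_norm_grad_le hR (siteEquiv k (0, 1))
  refine ⟨384 * (C₁ + C₂ + 1), max 1 (max K₁ K₂), by positivity, fun u T B hT hu => ?_⟩
  obtain ⟨hT, hTK₁, hTK₂⟩ : 1 ≤ T ∧ K₁ ≤ T ∧ K₂ ≤ T := by simpa using hT
  have hB : ∀ x : Site k, T ≤ ‖(x : ℂ)‖ → 0 ≤ B := fun x hx => (norm_nonneg _).trans (hu x hx)
  have hlow : ∀ p : ℤ × ℤ, 4 * T ≤ ‖p‖ → 2 * T ≤ ‖(siteEquiv k p : ℂ)‖ := fun p hp => by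
    linarith [norm_le_siteEquiv (k := k) p]
  have hstep₁ : ∀ p : ℤ × ℤ, 4 * T ≤ ‖p‖ →
      |u (siteEquiv k (p + (1, 0))) - u (siteEquiv k p)| ≤ (C₁ + C₂) * B := fun p hp => by
    rw [map_add]
    have := h₁ u T B hu (siteEquiv k p) (by linarith [hlow p hp])
    nlinarith [hB (siteEquiv k p) (by linarith [hlow p hp])]
  have hstep₂ : ∀ p : ℤ × ℤ, 4 * T ≤ ‖p‖ →
      |u (siteEquiv k (p + (0, 1))) - u (siteEquiv k p)| ≤ (C₁ + C₂) * B := fun p hp => by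
    rw [map_add]
    have := h₂ u T B hu (siteEquiv k p) (by linarith [hlow p hp])
    nlinarith [hB (siteEquiv k p) (by linarith [hlow p hp])]
  have hm : ‖⌈4 * T⌉‖ ∈ Icc (4 * T) (96 * T) := by
    have := Int.le_ceil (4 * T)
    rw [Int.norm_eq_abs, abs_of_nonneg (by linarith)]
    exact ⟨this, by linarith [Int.ceil_lt_add_one (4 * T)]⟩
  refine ⟨u (siteEquiv k (⌈4 * T⌉, ⌈4 * T⌉)), fun x hx8 hx48 => ?_⟩
  have hp : ‖(siteEquiv k).symm x‖ ∈ Icc (4 * T) (96 * T) :=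
    ⟨by linarith [norm_le_siteEquiv_symm x], by linarith [norm_siteEquiv_symm_le x]⟩
  have hosc := abs_sub_le_of_norm_mem_Icc (f := u ∘ siteEquiv k) hm hstep₁ hstep₂ hp
  simp only [Function.comp_apply, AddEquiv.apply_symm_apply] at hosc
  refine hosc.trans ?_
  nlinarith [mul_nonneg (zero_le_one.trans hT) (hB x (by linarith))]

/-- The function `u - a` cut off at radius `J`. -/
def truncation (J a : ℝ) (u : Site k → ℝ) (x : Site k) : ℝ := cutoff J x * (u x - a)

theorem truncation_eq_zero {J : ℝ} (hJ : 0 < J) (a : ℝ) (u : Site k → ℝ) {x : Site k}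
    (hx : 2 * J ≤ ‖(x : ℂ)‖) : truncation J a u x = 0 := by
  rw [truncation, cutoff_eq_zero hJ hx, zero_mul]

theorem finite_support_truncation {J : ℝ} (hJ : 0 < J) (a : ℝ) (u : Site k → ℝ) :
    (truncation J a u).support.Finite :=
  (finite_norm_lt k (2 * J)).subset fun _ hx => not_le.1 (mt (truncation_eq_zero hJ a u) hx)

theorem norm_sq_grad_truncation_sub_le {J a B : ℝ} (hJ : 0 < J) {u : Site k → ℝ}
    (hRJ : ∀ ρ ∈ R, 2 * ‖(ρ : ℂ)‖ ≤ J)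
    (hu : ∀ x : Site k, J / 2 ≤ ‖(x : ℂ)‖ → ‖(x : ℂ)‖ ≤ 3 * J → |u x - a| ≤ B) (x : Site k) :
    ‖grad R (truncation J a u - u) x‖ ^ 2 ≤
      (if J / 2 ≤ ‖(x : ℂ)‖ then 2 * ‖grad R u x‖ ^ 2 else 0) +
        if J / 2 ≤ ‖(x : ℂ)‖ ∧ ‖(x : ℂ)‖ ≤ 3 * J then
          2 * ((∑ ρ : R, ‖(ρ : ℂ)‖ ^ 2) / J ^ 2) * B ^ 2 else 0 := by
  have hadd : ∀ ρ ∈ R, ‖((x + ρ : Site k) : ℂ)‖ ≤ ‖(x : ℂ)‖ + J / 2 ∧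
      ‖(x : ℂ)‖ - J / 2 ≤ ‖((x + ρ : Site k) : ℂ)‖ := fun ρ hρ => by
    have h₁ := norm_add_le (x : ℂ) ρ
    have h₂ := norm_sub_le_norm_add (x : ℂ) ρ
    rw [AddSubgroup.coe_add]
    constructor <;> linarith [hRJ ρ hρ]
  have hprod := norm_sq_grad_truncation_le (R := R) (cutoff_nonneg J) (cutoff_le_one J) u a x
  rcases lt_or_ge ‖(x : ℂ)‖ (J / 2) with hlt | hge
  · have hone : ∀ y : Site k, ‖(y : ℂ)‖ ≤ J → (truncation J a u - u) y = -a := fun y hy => by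
      rw [Pi.sub_apply, truncation, cutoff_eq_one hJ hy]; ring
    rw [grad_eq_zero_of_eq (hone x (by linarith)) fun ρ hρ => hone _ (by linarith [(hadd ρ hρ).1])]
    simp [hlt.not_ge]
  · rw [if_pos hge]
    refine hprod.trans (add_le_add_right ?_ _)
    rcases le_or_gt ‖(x : ℂ)‖ (3 * J) with hle | hgt
    · rw [if_pos ⟨hge, hle⟩]
      have hsq := sq_le_sq' (neg_le_of_abs_le (hu x hge hle)) (le_of_abs_le (hu x hge hle))
      exact mul_le_mul (mul_le_mul_of_nonneg_left (norm_sq_grad_cutoff_le hJ x) two_pos.le) hsq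
        (sq_nonneg _) (by positivity)
    · rw [grad_eq_zero_of_eq (cutoff_eq_zero hJ (by linarith))
        fun ρ hρ => cutoff_eq_zero hJ (by linarith [(hadd ρ hρ).2])]
      simp [hgt.not_ge]

theorem norm_sq_le_of_forall_sum_le {v : HDot R} {A : ℝ}
    (h : ∀ S : Finset (Site k), ∑ x ∈ S, ‖grad R v x‖ ^ 2 ≤ A) : ‖v‖ ^ 2 ≤ A := by
  rw [← (hasSum_norm_grad_sq v).tsum_eq]
  exact (hasSum_norm_grad_sq v).summable.tsum_le_of_sum_le h

theorem norm_sq_truncation_sub_le {J a A B : ℝ} (hJ : 1 ≤ J) {u : HDot R}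
    (hRJ : ∀ ρ ∈ R, 2 * ‖(ρ : ℂ)‖ ≤ J)
    (hu : ∀ x : Site k, J / 2 ≤ ‖(x : ℂ)‖ → ‖(x : ℂ)‖ ≤ 3 * J → |u x - a| ≤ B)
    (htail : ∀ S : Finset (Site k), (∀ x ∈ S, J / 2 ≤ ‖(x : ℂ)‖) →
      ∑ x ∈ S, ‖grad R u x‖ ^ 2 ≤ A) :
    ‖ofFinite R (truncation J a u) (finite_support_truncation (by linarith) a u) - u‖ ^ 2 ≤
      2 * A + 450 * (∑ ρ : R, ‖(ρ : ℂ)‖ ^ 2) * B ^ 2 := by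
  have hJ0 : 0 < J := by linarith
  refine norm_sq_le_of_forall_sum_le fun S => ?_
  refine (Finset.sum_le_sum fun x _ => norm_sq_grad_truncation_sub_le hJ0 hRJ hu x).trans ?_
  rw [Finset.sum_add_distrib, ← Finset.sum_filter, ← Finset.sum_filter, ← Finset.mul_sum,
    Finset.sum_const, nsmul_eq_mul]
  have hcard := card_le_of_norm_le (b := 3 * J) (by linarith)
    (S := {x ∈ S | J / 2 ≤ ‖(x : ℂ)‖ ∧ ‖(x : ℂ)‖ ≤ 3 * J}) fun x hx => (Finset.mem_filter.1 hx).2.2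
  have hfar := htail {x ∈ S | J / 2 ≤ ‖(x : ℂ)‖} fun x hx => (Finset.mem_filter.1 hx).2
  calc _ ≤ 2 * A + 25 * (3 * J) ^ 2 * (2 * ((∑ ρ : R, ‖(ρ : ℂ)‖ ^ 2) / J ^ 2) * B ^ 2) := by gcongr
    _ = 2 * A + 450 * (∑ ρ : R, ‖(ρ : ℂ)‖ ^ 2) * B ^ 2 := by field_simp; ring

variable {s C₀ r₀ : ℝ} {r : ℕ} {u : HDot R}

theorem exists_norm_grad_le_truncRate (hs : 1 < s)
    (hdecay : ∀ x : Site k, r₀ ≤ ‖(x : ℂ)‖ →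
      ‖grad R u x‖ ≤ C₀ * ‖(x : ℂ)‖ ^ (-s) * Real.log ‖(x : ℂ)‖ ^ r) :
    ∃ C T₀ : ℝ, 0 < C ∧ ∀ T, T₀ ≤ T → ∀ x : Site k, T ≤ ‖(x : ℂ)‖ →
      ‖grad R u x‖ ≤ C * (truncRate s r T / T) * (‖(x : ℂ)‖ / T) ^ (-((s + 1) / 2)) := by
  obtain ⟨C, hC, hrate⟩ := exists_rpow_mul_log_pow_le hs r
  refine ⟨(|C₀| + 1) * C, max (Real.exp 1) r₀, by positivity, fun T hT x hx => ?_⟩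
  obtain ⟨hTe, hTr⟩ := max_le_iff.1 hT
  have hlog : 0 ≤ Real.log ‖(x : ℂ)‖ :=
    Real.log_nonneg ((Real.one_le_exp zero_le_one).trans (hTe.trans hx))
  calc ‖grad R u x‖ ≤ C₀ * (‖(x : ℂ)‖ ^ (-s) * Real.log ‖(x : ℂ)‖ ^ r) := by
        rw [← mul_assoc]
        exact hdecay x (hTr.trans hx)
    _ ≤ (|C₀| + 1) * (‖(x : ℂ)‖ ^ (-s) * Real.log ‖(x : ℂ)‖ ^ r) := by
        gcongr
        linarith [le_abs_self C₀]
    _ ≤ (|C₀| + 1) * (C * (truncRate s r T / T) * (‖(x : ℂ)‖ / T) ^ (-((s + 1) / 2))) :=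
        mul_le_mul_of_nonneg_left (hrate T _ hTe hx) (by positivity)
    _ = _ := by ring

theorem exists_decay_le_truncRate (hs : 1 < s)
    (hdecay : ∀ x : Site k, r₀ ≤ ‖(x : ℂ)‖ →
      ‖grad R u x‖ ≤ C₀ * ‖(x : ℂ)‖ ^ (-s) * Real.log ‖(x : ℂ)‖ ^ r) :
    ∃ C T₀ : ℝ, 0 < C ∧ ∀ T, T₀ ≤ T →
      (∀ x : Site k, T ≤ ‖(x : ℂ)‖ → T * ‖grad R u x‖ ≤ C * truncRate s r T) ∧
      ∀ S : Finset (Site k), (∀ x ∈ S, T ≤ ‖(x : ℂ)‖) →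
        ∑ x ∈ S, ‖grad R u x‖ ^ 2 ≤ (C * truncRate s r T) ^ 2 := by
  obtain ⟨C, T₀, hC, hscaled⟩ := exists_norm_grad_le_truncRate hs hdecay
  obtain ⟨D, hD, hsum⟩ := exists_sum_norm_div_rpow_le (k := k) (α := s + 1) (by linarith)
  refine ⟨C * (1 + D), max T₀ 2, by positivity, fun T hT => ?_⟩
  obtain ⟨hT₀, hT2⟩ := max_le_iff.1 hT
  have hT0 : 0 < T := by linarith
  have hrate := truncRate_pos s r (show 1 < T by linarith)
  refine ⟨fun x hx => ?_, fun S hS => ?_⟩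
  · have hone : (‖(x : ℂ)‖ / T) ^ (-((s + 1) / 2)) ≤ 1 :=
      Real.rpow_le_one_of_one_le_of_nonpos ((one_le_div hT0).2 hx) (by linarith)
    calc T * ‖grad R u x‖ ≤ T * (C * (truncRate s r T / T) * 1) := by
          gcongr
          exact (hscaled T hT₀ x hx).trans (by gcongr)
      _ = C * 1 * truncRate s r T := by field_simp
      _ ≤ C * (1 + D) * truncRate s r T := by gcongr; linarith
  · calc ∑ x ∈ S, ‖grad R u x‖ ^ 2
        ≤ ∑ x ∈ S, (C * (truncRate s r T / T)) ^ 2 * (‖(x : ℂ)‖ / T) ^ (-(s + 1)) := by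
          refine Finset.sum_le_sum fun x hx => ?_
          refine (pow_le_pow_left₀ (norm_nonneg _) (hscaled T hT₀ x (hS x hx)) 2).trans_eq ?_
          rw [mul_pow, ← Real.rpow_mul_natCast (by positivity)]
          norm_num
      _ ≤ (C * (truncRate s r T / T)) ^ 2 * (D * T ^ 2) := by
          rw [← Finset.mul_sum]
          gcongr
          exact hsum T (by linarith) S hS
      _ = D * (C * truncRate s r T) ^ 2 := by field_simp
      _ ≤ (1 + D) ^ 2 * (C * truncRate s r T) ^ 2 := by gcongr; nlinarith
      _ = (C * (1 + D) * truncRate s r T) ^ 2 := by ring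

theorem exists_norm_truncation_sub_le (hR : AddSubgroup.closure (R : Set (Site k)) = ⊤)
    (hs : 1 < s)
    (hdecay : ∀ x : Site k, r₀ ≤ ‖(x : ℂ)‖ →
      ‖grad R u x‖ ≤ C₀ * ‖(x : ℂ)‖ ^ (-s) * Real.log ‖(x : ℂ)‖ ^ r) :
    ∃ C T₀ : ℝ, 0 < C ∧ 1 < T₀ ∧ ∀ T, T₀ ≤ T →
      ∃ v ∈ H0 R {x | ‖(x : ℂ)‖ < 32 * T}, ‖v - u‖ ≤ C * truncRate s r T := by
  obtain ⟨C₁, T₁, hC₁, hdecay'⟩ := exists_decay_le_truncRate hs hdecay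
  obtain ⟨C₂, T₂, hC₂, hosc⟩ := exists_abs_sub_le_of_norm_mem_annulus hR
  set q := ∑ ρ : R, ‖(ρ : ℂ)‖ ^ 2
  have hsum : 0 ≤ ∑ ρ ∈ R, ‖(ρ : ℂ)‖ := Finset.sum_nonneg fun ρ _ => norm_nonneg (ρ : ℂ)
  refine ⟨Real.sqrt (2 + 450 * q * C₂ ^ 2) * C₁, max (max T₁ T₂) (2 + ∑ ρ ∈ R, ‖(ρ : ℂ)‖),
    by positivity, lt_max_of_lt_right (by linarith), fun T hT => ?_⟩
  obtain ⟨⟨hT₁, hT₂⟩, hTR⟩ : (T₁ ≤ T ∧ T₂ ≤ T) ∧ 2 + ∑ ρ ∈ R, ‖(ρ : ℂ)‖ ≤ T := by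
    simpa only [max_le_iff] using hT
  have hT0 : 0 < T := by linarith
  have hrate := truncRate_pos s r (show 1 < T by linarith)
  obtain ⟨hpt, htail⟩ := hdecay' T hT₁
  obtain ⟨a, ha⟩ := hosc u T (C₁ * truncRate s r T / T) hT₂ fun x hx => by
    rw [le_div_iff₀' hT0]; exact hpt x hx
  rw [mul_div_cancel₀ _ hT0.ne'] at ha
  have hfin := finite_support_truncation (J := 16 * T) (by linarith) a u
  refine ⟨ofFinite R _ hfin, ⟨hfin, fun x hx => truncation_eq_zero (by linarith) a u
    (by linarith [not_lt.1 (mem_ofPred_eq ▸ hx)])⟩, ?_⟩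
  have hbound := norm_sq_truncation_sub_le (R := R) (J := 16 * T) (a := a) (u := u) (by linarith)
    (fun ρ hρ => by
      linarith [Finset.single_le_sum (fun (ρ : Site k) _ => norm_nonneg (ρ : ℂ)) hρ])
    (fun x h₁ h₂ => ha x (by linarith) (by linarith))
    (fun S hS => htail S fun x hx => by linarith [hS x hx])
  refine (abs_le_of_sq_le_sq' (hbound.trans_eq ?_) (by positivity)).2
  have hsqrt := Real.sq_sqrt (show 0 ≤ 2 + 450 * q * C₂ ^ 2 by positivity)
  linear_combination -(C₁ * truncRate s r T) ^ 2 * hsqrt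

theorem exists_truncation (hR : AddSubgroup.closure (R : Set (Site k)) = ⊤) (hs : 1 < s)
    (hdecay : ∀ x : Site k, r₀ ≤ ‖(x : ℂ)‖ →
      ‖grad R u x‖ ≤ C₀ * ‖(x : ℂ)‖ ^ (-s) * Real.log ‖(x : ℂ)‖ ^ r) :
    ∃ C R₀ : ℝ, 0 < C ∧ ∀ ρ, R₀ ≤ ρ →
      ∃ v ∈ H0 R {x | ‖(x : ℂ)‖ < ρ}, ‖v - u‖ ≤ C * truncRate s r ρ := by
  obtain ⟨C, T₀, hC, hT₀, htrunc⟩ := exists_norm_truncation_sub_le hR hs hdecay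
  refine ⟨C * 32 ^ (s - 1), 32 * T₀, by positivity, fun ρ hρ => ?_⟩
  obtain ⟨v, hv, hvu⟩ := htrunc (ρ / 32) (by linarith)
  rw [mul_div_cancel₀ _ (by norm_num)] at hv
  refine ⟨v, hv, hvu.trans ?_⟩
  rw [mul_assoc]
  exact mul_le_mul_of_nonneg_left (truncRate_div_le r (by norm_num) (by linarith)) hC.le

theorem mem_closure_Hc_of_decay (hR : AddSubgroup.closure (R : Set (Site k)) = ⊤) (hs : 1 < s)
    (hdecay : ∀ x : Site k, r₀ ≤ ‖(x : ℂ)‖ →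
      ‖grad R u x‖ ≤ C₀ * ‖(x : ℂ)‖ ^ (-s) * Real.log ‖(x : ℂ)‖ ^ r) : u ∈ closure (Hc R) := by
  obtain ⟨C, R₀, -, htrunc⟩ := exists_truncation hR hs hdecay
  have hlim : Tendsto (fun ρ => C * truncRate s r ρ) atTop (𝓝 0) := by
    simpa using (tendsto_truncRate hs r).const_mul C
  refine Metric.mem_closure_iff.2 fun ε hε => ?_
  obtain ⟨ρ, hρ, hlt⟩ := ((eventually_ge_atTop R₀).and (hlim.eventually_lt_const hε)).exists
  obtain ⟨v, hv, hvu⟩ := htrunc ρ hρ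
  exact ⟨v, hv.1, by rw [dist_comm, dist_eq_norm]; exact hvu.trans_lt hlt⟩

end Truncation

/-! ### Forces that are bounded in the energy norm -/

section Forces

variable {R : Finset (Site k)} {v : HDot R}

theorem summable_mul_of_mem_Hc (c : Site k → ℝ) (hv : v ∈ Hc R) : Summable fun x => c x * v x :=
  summable_of_hasFiniteSupport (hv.subset (Function.support_mul_subset_right c v))

/-- The forces whose pairing with compactly supported displacements is bounded in the energy
norm. -/
def boundedForces (R : Finset (Site k)) : Submodule ℝ (Site k → ℝ) where
  carrier := {c | ∃ C, ∀ v ∈ Hc R, |∑' x, c x * v x| ≤ C * ‖v‖}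
  zero_mem' := ⟨0, fun v _ => by simp⟩
  add_mem' := by
    rintro c d ⟨C, hC⟩ ⟨D, hD⟩
    refine ⟨C + D, fun v hv => ?_⟩
    simp only [Pi.add_apply, add_mul]
    rw [(summable_mul_of_mem_Hc c hv).tsum_add (summable_mul_of_mem_Hc d hv)]
    exact (abs_add_le _ _).trans (add_le_add (hC v hv) (hD v hv))
  smul_mem' := by
    rintro t c ⟨C, hC⟩
    refine ⟨|t| * C, fun v hv => ?_⟩
    simp only [Pi.smul_apply, smul_eq_mul, mul_assoc]
    rw [tsum_mul_left, abs_mul]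
    exact mul_le_mul_of_nonneg_left (hC v hv) (abs_nonneg t)

/-- The force exerted by the stress `f` on the bonds in direction `e`; it is the negative discrete
divergence, adjoint to the difference in direction `e`. -/
def bondForce (e : Site k) : (Site k → ℝ) →ₗ[ℝ] Site k → ℝ where
  toFun f x := f (x - e) - f x
  map_add' f g := by
    funext x
    simp only [Pi.add_apply]
    ring
  map_smul' t f := by
    funext x
    simp only [Pi.smul_apply, smul_eq_mul, RingHom.id_apply]
    ring

theorem bondForce_apply (e : Site k) (f : Site k → ℝ) (x : Site k) :
    bondForce e f x = f (x - e) - f x := rfl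

theorem tsum_bondForce_mul (e : Site k) (f : Site k → ℝ) (hv : v ∈ Hc R) :
    ∑' x, bondForce e f x * v x = ∑' x, f x * (v (x + e) - v x) := by
  have hleft : Summable fun x => f (x - e) * v x := summable_mul_of_mem_Hc (fun x => f (x - e)) hv
  have hright : HasSum (fun x => f x * v (x + e)) (∑' x, f (x - e) * v x) := by
    have hshift := (Equiv.addRight e).hasSum_iff (f := fun x => f (x - e) * v x)
      (a := ∑' x, f (x - e) * v x)
    simp only [Function.comp_def, Equiv.coe_addRight, add_sub_cancel_right] at hshift
    exact hshift.2 hleft.hasSum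
  have hf := (summable_mul_of_mem_Hc f hv).hasSum
  simp only [bondForce_apply, sub_mul, mul_sub]
  rw [(hleft.hasSum.sub hf).tsum_eq, (hright.sub hf).tsum_eq]

theorem bondForce_mem_boundedForces (hR : AddSubgroup.closure (R : Set (Site k)) = ⊤)
    (e : Site k) {f : Site k → ℝ} (hf : Summable fun x => f x ^ 2) :
    bondForce e f ∈ boundedForces R := by
  obtain ⟨C, hC, hdiff⟩ := exists_tsum_sub_sq_le hR e
  let f₂ : lp (fun _ : Site k => ℝ) 2 := ⟨f, memℓp_gen (by simpa using hf)⟩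
  refine ⟨‖f₂‖ * Real.sqrt C, fun v hv => ?_⟩
  obtain ⟨hsum, hle⟩ := hdiff v
  let d₂ : lp (fun _ : Site k => ℝ) 2 :=
    ⟨fun x => v (x + e) - v x, memℓp_gen (by simpa using hsum)⟩
  have hd₂ : ‖d₂‖ ≤ Real.sqrt C * ‖v‖ := by
    refine le_of_sq_le_sq ?_ (by positivity)
    rw [mul_pow, Real.sq_sqrt hC, ← tsum_norm_sq]
    simpa [d₂] using hle
  have hcs : |∑' x, f x * (v (x + e) - v x)| ≤ 1 * (‖f₂‖ * ‖d₂‖) :=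
    norm_tsum_le_of_norm_le_mul zero_le_one fun x => by rw [one_mul, norm_mul]
  rw [tsum_bondForce_mul e f hv, mul_assoc]
  exact hcs.trans (by rw [one_mul]; gcongr)

theorem mkQ_bondForce_congr (hR : AddSubgroup.closure (R : Set (Site k)) = ⊤) (e : Site k)
    {f g : Site k → ℝ} (hfg : Summable fun x => (f x - g x) ^ 2) :
    (boundedForces R).mkQ (bondForce e f) = (boundedForces R).mkQ (bondForce e g) := by
  rw [← sub_eq_zero, ← map_sub, ← map_sub]
  exact (Submodule.Quotient.mk_eq_zero _).2 (bondForce_mem_boundedForces hR e hfg)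

theorem mkQ_bondForce_add (hR : AddSubgroup.closure (R : Set (Site k)) = ⊤) {d : Site k}
    {f : Site k → ℝ} (hf : Summable fun x => bondForce d f x ^ 2) (e : Site k) :
    (boundedForces R).mkQ (bondForce (d + e) f)
      = (boundedForces R).mkQ (bondForce d f) + (boundedForces R).mkQ (bondForce e f) := by
  have hdefect : bondForce (d + e) f - (bondForce d f + bondForce e f)
      = bondForce e (bondForce d f) := by
    funext x
    simp only [Pi.sub_apply, Pi.add_apply, bondForce_apply, add_comm d e, ← sub_sub]
    ring
  rw [← map_add, ← sub_eq_zero, ← map_sub, hdefect]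
  exact (Submodule.Quotient.mk_eq_zero _).2 (bondForce_mem_boundedForces hR e hf)

theorem exists_continuousLinearMap_of_mem_boundedForces {c : Site k → ℝ}
    (hc : c ∈ boundedForces R) : ∃ L : HDot R →L[ℝ] ℝ, ∀ v ∈ Hc R, L v = ∑' x, c x * v x := by
  obtain ⟨C, hC⟩ := hc
  have mem_Hc : ∀ v : H0Submodule R univ, v.1 ∈ Hc R := fun v => v.2.1
  let pairing : H0Submodule R univ →ₗ[ℝ] ℝ :=
    { toFun := fun v => ∑' x, c x * v.1 x
      map_add' := fun v w => by
        rw [← (summable_mul_of_mem_Hc c (mem_Hc v)).tsum_add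
          (summable_mul_of_mem_Hc c (mem_Hc w))]
        exact tsum_congr fun x => mul_add _ _ _
      map_smul' := fun t v => by
        rw [RingHom.id_apply, smul_eq_mul, ← tsum_mul_left]
        exact tsum_congr fun x => mul_left_comm _ _ _ }
  obtain ⟨L, hL, -⟩ := exists_extension_norm_eq (H0Submodule R univ)
    (pairing.mkContinuous C fun v => hC v (mem_Hc v))
  exact ⟨L, fun v hv => hL ⟨v, hv, fun x hx => (hx (mem_univ x)).elim⟩⟩

open scoped Classical in
theorem tsum_clm_grad (φ : Site k → EuclideanSpace ℝ R →L[ℝ] ℝ) (hv : v ∈ Hc R) :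
    ∑' x, φ x (grad R v x)
      = ∑' x, (∑ σ : R, bondForce (σ : Site k) fun x => φ x (EuclideanSpace.single σ 1)) x
        * v x := by
  have hcomponents : ∀ x, φ x (grad R v x)
      = ∑ σ : R, φ x (EuclideanSpace.single σ 1) * (v (x + σ) - v x) := fun x => by
    have hgrad : grad R v x
        = ∑ σ : R, (v (x + σ) - v x) • EuclideanSpace.single σ (1 : ℝ) := by
      ext τ
      simp [grad, Pi.single_apply]
    conv_lhs => rw [hgrad, map_sum]
    simp only [map_smul, smul_eq_mul, mul_comm]
  have hsum : ∀ σ : R, Summable fun x =>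
      φ x (EuclideanSpace.single σ 1) * (v (x + σ) - v x) := fun σ =>
    summable_of_hasFiniteSupport <| (finite_support_grad (R := R) hv).subset fun x hx hx' =>
      hx (mul_eq_zero_of_right _ (congrArg (· σ) hx'))
  simp only [hcomponents, Finset.sum_apply, Finset.sum_mul]
  rw [Summable.tsum_finsetSum fun σ _ => hsum σ,
    Summable.tsum_finsetSum fun σ _ => summable_mul_of_mem_Hc _ hv]
  exact Finset.sum_congr rfl fun σ _ => (tsum_bondForce_mul _ _ hv).symm

end Forces

/-! ### Asymptotics relative to the core -/

section Asymptotics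

open Asymptotics

/-- The position of a lattice site relative to the dislocation core. -/
def rel (xhat : ℂ) (x : Site k) : ℂ := (x : ℂ) - xhat

variable {xhat : ℂ}

theorem rel_add (x e : Site k) : rel xhat (x + e) = rel xhat x + e := by
  rw [rel, rel, AddSubgroup.coe_add, add_sub_right_comm]

theorem rel_sub (x e : Site k) : rel xhat (x - e) = rel xhat x - e := by
  rw [rel, rel, AddSubgroup.coe_sub, sub_right_comm]

theorem rel_ne_zero (hx : xhat ∉ lattice k) (x : Site k) : rel xhat x ≠ 0 := fun h =>
  hx (sub_eq_zero.1 h ▸ x.2)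

theorem one_add_div_rel (hx : xhat ∉ lattice k) (x e : Site k) :
    1 + (e : ℂ) / rel xhat x = rel xhat (x + e) / rel xhat x := by
  rw [rel_add, add_div, div_self (rel_ne_zero hx x)]

variable (k xhat) in
theorem isEquivalent_rel : rel xhat ~[cofinite] fun x : Site k => (x : ℂ) :=
  (IsEquivalent.refl.add_const_of_norm_tendsto_atTop (c := -xhat)
    (tendsto_norm_cofinite k)).congr_left <| .of_forall fun x => (sub_eq_add_neg (x : ℂ) xhat).symm

variable (k xhat) in
theorem tendsto_norm_rel : Tendsto (norm ∘ rel (k := k) xhat) cofinite atTop :=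
  tendsto_atTop_mono (fun x => norm_sub_norm_le (x : ℂ) xhat)
    (tendsto_atTop_add_const_right _ _ (tendsto_norm_cofinite k))

theorem summable_sq_of_isBigO {f : Site k → ℝ}
    (hf : f =O[cofinite] fun x => (rel xhat x)⁻¹ ^ 2) : Summable fun x => f x ^ 2 := by
  refine summable_of_isBigO (summable_norm_rpow (k := k) (show (2 : ℝ) < 4 by norm_num)) ?_
  refine ((hf.trans ((isEquivalent_rel k xhat).inv.pow 2).isBigO).pow 2).trans
    (isBigO_of_le _ fun x => ?_)
  simp [← pow_mul]

theorem isBigO_inv_rel_sub_sub (e : Site k) :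
    (fun x => (rel xhat (x - e))⁻¹ - (rel xhat x)⁻¹)
      =O[cofinite] fun x => (rel xhat x)⁻¹ ^ 2 := by
  have hequiv : (fun x => rel xhat (x - e)) ~[cofinite] rel xhat := by
    refine (IsEquivalent.refl.add_const_of_norm_tendsto_atTop (c := -(e : ℂ))
      (tendsto_norm_rel k xhat)).congr_left (.of_forall fun x => ?_)
    exact (sub_eq_add_neg _ _).symm.trans (rel_sub x e).symm
  have hprod : (fun x => e * ((rel xhat (x - e))⁻¹ * (rel xhat x)⁻¹))
      =O[cofinite] fun x => (rel xhat x)⁻¹ ^ 2 := by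
    simpa only [sq, Pi.inv_apply] using
      (hequiv.inv.isBigO.mul (isBigO_refl _ _)).const_mul_left (e : ℂ)
  refine hprod.congr' ?_ .rfl
  filter_upwards [(tendsto_norm_rel k xhat).eventually_gt_atTop ‖(e : ℂ)‖] with x hx
  have hne : rel xhat x ≠ 0 := norm_pos_iff.1 ((norm_nonneg _).trans_lt hx)
  have hne' : rel xhat (x - e) ≠ 0 := fun h => hx.ne' (by
    rw [rel_sub, sub_eq_zero] at h
    exact congrArg norm h)
  rw [inv_sub_inv hne' hne, rel_sub, sub_sub_cancel, div_eq_mul_inv, mul_inv]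

theorem isBigO_log_sub (e : Site k) :
    (fun x : Site k => Complex.log (1 + e / rel xhat x) - e / rel xhat x)
      =O[cofinite] fun x => (rel xhat x)⁻¹ ^ 2 := by
  have hlim : Tendsto (fun x : Site k => (e : ℂ) / rel xhat x) cofinite (𝓝 0) :=
    tendsto_zero_iff_norm_tendsto_zero.2 <| by
      simpa only [norm_div, Function.comp_def] using
        (tendsto_const_nhds (x := ‖(e : ℂ)‖)).div_atTop (tendsto_norm_rel k xhat)
  refine (Complex.log_sub_self_isBigO.comp_tendsto hlim).trans ?_
  simpa only [Function.comp_def, div_eq_mul_inv, mul_pow]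
    using (isBigO_refl _ _).const_mul_left ((e : ℂ) ^ 2)

/-- The harmonic function `Im (c / z)`, where `z` is the position relative to the core. -/
def imInv (xhat : ℂ) : ℂ →ₗ[ℝ] Site k → ℝ where
  toFun c x := (c * (rel xhat x)⁻¹).im
  map_add' c d := by
    funext x
    rw [add_mul, Complex.add_im, Pi.add_apply]
  map_smul' t c := by
    funext x
    rw [smul_mul_assoc, Complex.smul_im, Pi.smul_apply, RingHom.id_apply]

theorem imInv_apply (c : ℂ) (x : Site k) : imInv xhat c x = (c * (rel xhat x)⁻¹).im := rfl

theorem summable_bondForce_imInv_sq (c : ℂ) (e : Site k) :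
    Summable fun x => bondForce e (imInv xhat c) x ^ 2 := by
  refine summable_sq_of_isBigO (xhat := xhat) (((Complex.imCLM.isBigO_comp _ _).trans
    ((isBigO_inv_rel_sub_sub e).const_mul_left c)).congr_left fun x => ?_)
  rw [bondForce_apply, imInv_apply, imInv_apply, ← Complex.sub_im, mul_sub]
  rfl

theorem imInv_mul_I (c : ℂ) (x : Site k) :
    imInv xhat (c * Complex.I) x = (c / rel xhat x).re := by
  rw [imInv_apply, mul_right_comm, Complex.mul_I_im, div_eq_mul_inv]

/-- Up to a square-summable error, `Re (e / z)` is a difference of `log ‖z‖`. -/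
theorem isBigO_log_norm_sub (hx : xhat ∉ lattice k) (e : Site k) :
    (fun x => Real.log ‖rel xhat (x + e)‖ - Real.log ‖rel xhat x‖
      - imInv xhat (e * Complex.I) x) =O[cofinite] fun x => (rel xhat x)⁻¹ ^ 2 := by
  refine ((Complex.reCLM.isBigO_comp _ _).trans (isBigO_log_sub e)).congr_left fun x => ?_
  rw [Complex.reCLM_apply, Complex.sub_re, Complex.log_re, one_add_div_rel hx, norm_div,
    Real.log_div (norm_ne_zero_iff.2 (rel_ne_zero hx _)) (norm_ne_zero_iff.2 (rel_ne_zero hx _)),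
    imInv_mul_I]

end Asymptotics

/-! ### The force exerted by a harmonic stress field -/

section HarmonicForce

variable {R : Finset (Site k)} {xhat : ℂ}

/-- The force exerted by the stress `Im (c / z)` on the bonds in direction `e`, modulo forces that
are bounded in the energy norm. -/
def forceClass (R : Finset (Site k)) (xhat : ℂ) (e : Site k) :
    ℂ →ₗ[ℝ] (Site k → ℝ) ⧸ boundedForces R :=
  (boundedForces R).mkQ ∘ₗ bondForce e ∘ₗ imInv xhat

theorem forceClass_apply (e : Site k) (c : ℂ) :
    forceClass R xhat e c = (boundedForces R).mkQ (bondForce e (imInv xhat c)) := rfl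

theorem forceClass_siteEquiv (hR : AddSubgroup.closure (R : Set (Site k)) = ⊤) (p : ℤ × ℤ)
    (c : ℂ) : forceClass R xhat (siteEquiv k p) c
      = forceClass R xhat (siteEquiv k (1, 0)) (p.1 • c)
        + forceClass R xhat (siteEquiv k (0, 1)) (p.2 • c) := by
  let Φ : ℤ × ℤ →+ (Site k → ℝ) ⧸ boundedForces R :=
    AddMonoidHom.mk' (fun p => forceClass R xhat (siteEquiv k p) c) fun p q => by
      rw [map_add]
      exact mkQ_bondForce_add hR (summable_bondForce_imInv_sq c _) _
  have hp : p = p.1 • ((1, 0) : ℤ × ℤ) + p.2 • ((0, 1) : ℤ × ℤ) := by ext <;> simp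
  rw [map_zsmul, map_zsmul]
  calc Φ p = Φ (p.1 • (1, 0) + p.2 • (0, 1)) := congrArg Φ hp
    _ = p.1 • Φ (1, 0) + p.2 • Φ (0, 1) := by rw [map_add, map_zsmul, map_zsmul]

/-- The symmetry of second differences, applied to `log ‖z‖`. -/
theorem forceClass_mul_I (hR : AddSubgroup.closure (R : Set (Site k)) = ⊤)
    (hx : xhat ∉ lattice k) (e f : Site k) :
    forceClass R xhat f (e * Complex.I) = forceClass R xhat e (f * Complex.I) := by
  let g : Site k → ℝ := fun x => Real.log ‖rel xhat x‖
  have hsymm : bondForce f (fun x => g (x + e) - g x)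
      = bondForce e fun x => g (x + e) - g (x + (e - f)) := by
    funext x
    simp only [bondForce_apply]
    rw [show x - e + e = x by abel, show x - f + e = x + (e - f) by abel,
      show x - e + (e - f) = x - f by abel]
    ring
  have hleft := mkQ_bondForce_congr hR f (summable_sq_of_isBigO (isBigO_log_norm_sub hx e))
  have hright := mkQ_bondForce_congr hR e (f := fun x => g (x + e) - g (x + (e - f)))
    (g := imInv xhat (f * Complex.I)) (summable_sq_of_isBigO (xhat := xhat)
      (((isBigO_log_norm_sub hx e).sub (isBigO_log_norm_sub hx (e - f))).congr_left fun x => by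
        rw [AddSubgroup.coe_sub, sub_mul, map_sub, Pi.sub_apply]
        ring))
  rw [forceClass_apply, forceClass_apply, ← hleft, ← hright]
  exact congrArg _ hsymm

/-- The moment conditions leave, in lattice coordinates, only a real multiple of the
Cauchy–Riemann pair `(-τ I, I)`. -/
theorem exists_sum_zsmul_eq {ι : Type*} [Fintype ι] {τ : ℂ} (hτ : τ.im ≠ 0) {p : ι → ℤ × ℤ}
    {a : ι → ℂ} (h₁ : ∑ i, a i * ((p i).1 + (p i).2 * τ) = 0)
    (h₂ : (∑ i, a i * (starRingEnd ℂ) ((p i).1 + (p i).2 * τ)).im = 0) :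
    ∃ t : ℝ, ∑ i, (p i).1 • a i = -(t • (τ * Complex.I)) ∧
      ∑ i, (p i).2 • a i = t • Complex.I := by
  set α := ∑ i, (p i).1 • a i with hα
  set β := ∑ i, (p i).2 • a i with hβ
  have hmoment : ∀ w : ℂ, ∑ i, a i * ((p i).1 + (p i).2 * w) = α + β * w := fun w => by
    rw [hα, hβ, Finset.sum_mul, ← Finset.sum_add_distrib]
    refine Finset.sum_congr rfl fun i _ => ?_
    rw [zsmul_eq_mul, zsmul_eq_mul]
    ring
  simp only [map_add, map_mul, map_intCast] at h₂
  rw [hmoment] at h₁ h₂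
  have hre : β.re = 0 := by
    have hdiff : α + β * (starRingEnd ℂ) τ = -(2 * τ.im : ℝ) * (β * Complex.I) := by
      linear_combination h₁ - β * Complex.sub_conj τ
    rw [hdiff] at h₂
    simpa [hτ] using h₂
  have hβI : β = β.im • Complex.I := by
    apply Complex.ext <;> simp [hre]
  refine ⟨β.im, ?_, hβI⟩
  rw [mul_comm τ, ← smul_mul_assoc, ← hβI]
  exact eq_neg_of_add_eq_zero_left h₁

theorem sum_forceClass_eq_zero (hR : AddSubgroup.closure (R : Set (Site k)) = ⊤)
    (hx : xhat ∉ lattice k) {ι : Type*} [Fintype ι] {e : ι → Site k} {a : ι → ℂ}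
    (h₁ : ∑ i, a i * e i = 0) (h₂ : (∑ i, a i * (starRingEnd ℂ) (e i : ℂ)).im = 0) :
    ∑ i, forceClass R xhat (e i) (a i) = 0 := by
  obtain ⟨p, rfl⟩ : ∃ p : ι → ℤ × ℤ, e = fun i => siteEquiv k (p i) :=
    ⟨fun i => (siteEquiv k).symm (e i), by simp⟩
  simp only [coe_siteEquiv] at h₁ h₂
  obtain ⟨t, hα, hβ⟩ := exists_sum_zsmul_eq k.tau_im_pos.ne' h₁ h₂
  have hCR := forceClass_mul_I hR hx (siteEquiv k (0, 1)) (siteEquiv k (1, 0))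
  simp only [coe_siteEquiv, Int.cast_zero, Int.cast_one, zero_add, one_mul, zero_mul, add_zero]
    at hCR
  rw [Finset.sum_congr rfl fun i _ => forceClass_siteEquiv hR (p i) (a i),
    Finset.sum_add_distrib, ← map_sum, ← map_sum, hα, hβ, map_neg, map_smul, map_smul, hCR,
    neg_add_cancel]

end HarmonicForce

/-! ### Moment conditions from lattice symmetry -/

section LatticeSymmetry

theorem LatticeKind.rot_sq_ne_one (k : LatticeKind) : k.rot ^ 2 ≠ 1 := by
  intro h
  cases k with
  | square =>
    have hre := congrArg Complex.re h
    norm_num [LatticeKind.rot, sq] at hre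
  | triangular =>
    have him := congrArg Complex.im h
    norm_num [LatticeKind.rot, sq] at him
    linarith [Real.sqrt_pos.2 (zero_lt_three : (0 : ℝ) < 3)]

theorem fderiv_fderiv_zero_perm {ι : Type*} [Fintype ι] [DecidableEq ι]
    {V : EuclideanSpace ℝ ι → ℝ} (hV : ContDiff ℝ 2 V) {π : Equiv.Perm ι}
    (hπ : ∀ A : EuclideanSpace ℝ ι, V A = V (WithLp.toLp 2 fun ρ => A (π ρ))) (ρ σ : ι) :
    fderiv ℝ (fderiv ℝ V) 0 (EuclideanSpace.single (π ρ) 1) (EuclideanSpace.single (π σ) 1)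
      = fderiv ℝ (fderiv ℝ V) 0 (EuclideanSpace.single ρ 1) (EuclideanSpace.single σ 1) := by
  let T : EuclideanSpace ℝ ι ≃ₗᵢ[ℝ] EuclideanSpace ℝ ι :=
    LinearIsometryEquiv.piLpCongrLeft 2 ℝ ℝ π.symm
  have hVT : V ∘ T.toContinuousLinearEquiv.toContinuousLinearMap = V := funext fun A => (hπ A).symm
  have hT : ∀ ρ, T (EuclideanSpace.single (π ρ) 1) = EuclideanSpace.single ρ 1 := fun ρ =>
    (LinearIsometryEquiv.piLpCongrLeft_single π.symm _ _).trans (by rw [π.symm_apply_apply])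
  have hcomp := T.toContinuousLinearEquiv.toContinuousLinearMap.iteratedFDeriv_comp_right hV 0
    (i := 2) le_rfl
  rw [hVT] at hcomp
  have happly := DFunLike.congr_fun hcomp
    ![EuclideanSpace.single (π ρ) 1, EuclideanSpace.single (π σ) 1]
  simpa [iteratedFDeriv_two_apply, hT] using happly

variable {R : Finset (Site k)} {H : EuclideanSpace ℝ R →L[ℝ] EuclideanSpace ℝ R →L[ℝ] ℝ}

open scoped Classical in
/-- The complex coefficient `c` such that `Im (c / z)` is, up to a factor, the stress that the
elastic moduli `H` assign to the bond `σ` under the leading-order strain of a screw dislocation. -/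
def stressCoeff (H : EuclideanSpace ℝ R →L[ℝ] EuclideanSpace ℝ R →L[ℝ] ℝ) (σ : R) : ℂ :=
  ∑ ρ : R, (H (EuclideanSpace.single ρ 1) (EuclideanSpace.single σ 1) : ℂ) * (ρ : Site k)

theorem im_sum_stressCoeff_mul_conj (hH : ∀ A B, H A B = H B A) :
    (∑ σ : R, stressCoeff H σ * (starRingEnd ℂ) ((σ : Site k) : ℂ)).im = 0 := by
  rw [← Complex.conj_eq_iff_im]
  simp only [stressCoeff, map_mul, map_sum, Complex.conj_conj, Complex.conj_ofReal,
    Finset.sum_mul]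
  rw [Finset.sum_comm]
  refine Finset.sum_congr rfl fun ρ _ => Finset.sum_congr rfl fun σ _ => ?_
  rw [hH, mul_right_comm]

open scoped Classical in
/-- The sum transforms by the factor `k.rot ^ 2 ≠ 1` under the lattice rotation. -/
theorem sum_stressCoeff_mul_eq_zero {π : Equiv.Perm R}
    (hrot : ∀ ρ : R, ((π ρ : Site k) : ℂ) = k.rot * ((ρ : Site k) : ℂ))
    (hH : ∀ ρ σ, H (EuclideanSpace.single (π ρ) 1) (EuclideanSpace.single (π σ) 1)
      = H (EuclideanSpace.single ρ 1) (EuclideanSpace.single σ 1)) :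
    ∑ σ : R, stressCoeff H σ * ((σ : Site k) : ℂ) = 0 := by
  have hcoeff : ∀ σ, stressCoeff H (π σ) = k.rot * stressCoeff H σ := fun σ => by
    rw [stressCoeff, ← Equiv.sum_comp π, stressCoeff, Finset.mul_sum]
    exact Finset.sum_congr rfl fun ρ _ => by rw [hH, hrot, mul_left_comm]
  have hsum : ∑ σ : R, stressCoeff H σ * ((σ : Site k) : ℂ)
      = k.rot ^ 2 * ∑ σ : R, stressCoeff H σ * ((σ : Site k) : ℂ) := by
    conv_lhs => rw [← Equiv.sum_comp π]
    rw [Finset.mul_sum]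
    exact Finset.sum_congr rfl fun σ _ => by rw [hcoeff, hrot, mul_mul_mul_comm, sq]
  by_contra hne
  exact k.rot_sq_ne_one ((mul_eq_right₀ hne).1 hsum.symm)

end LatticeSymmetry

/-! ### The strain and the force of the far-field predictor -/

section Predictor

open Asymptotics

variable {R : Finset (Site k)} {b : ℝ} {xhat : ℂ}

theorem SlipInvariant.int_mul {ι G : Type*} {f : EuclideanSpace ℝ ι → G} {p : ℝ}
    (h : SlipInvariant p f) (j : ℤ) : SlipInvariant (j * p) f := fun n A => by
  simpa only [Int.cast_mul, mul_assoc] using h (fun ρ => n ρ * j) A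

/-- The elastic strain of the predictor: its discrete gradient without the jumps across the branch
cut. -/
def elasticStrain (R : Finset (Site k)) (b : ℝ) (xhat : ℂ) (x : Site k) : EuclideanSpace ℝ R :=
  WithLp.toLp 2 fun ρ => b / (2 * Real.pi) * (Complex.log (1 + (ρ : Site k) / rel xhat x)).im

/-- The leading term of the elastic strain far from the core. -/
def leadingStrain (R : Finset (Site k)) (b : ℝ) (xhat : ℂ) (x : Site k) : EuclideanSpace ℝ R :=
  WithLp.toLp 2 fun ρ => b / (2 * Real.pi) * imInv xhat (ρ : Site k) x

theorem exists_argCut_sub_eq {z w : ℂ} (hz : z ≠ 0) (hw : w ≠ 0) :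
    ∃ n : ℤ, argCut z - argCut w = (z / w).arg + 2 * Real.pi * n := by
  have hangle : ((argCut z - argCut w : ℝ) : Real.Angle) = ((z / w).arg : Real.Angle) := by
    rw [Real.Angle.coe_sub, argCut, argCut, Real.Angle.coe_toIcoMod, Real.Angle.coe_toIcoMod,
      Complex.arg_div_coe_angle hz hw]
  obtain ⟨n, hn⟩ := Real.Angle.angle_eq_iff_two_pi_dvd_sub.1 hangle
  exact ⟨n, sub_eq_iff_eq_add'.1 hn⟩

theorem exists_grad_uHat_eq (b : ℝ) (hx : xhat ∉ lattice k) (x : Site k) : ∃ n : R → ℤ,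
    grad R (uHat b xhat) x = elasticStrain R b xhat x + WithLp.toLp 2 fun ρ => n ρ * b := by
  choose n hn using fun ρ : R =>
    exists_argCut_sub_eq (rel_ne_zero hx (x + (ρ : Site k))) (rel_ne_zero hx x)
  refine ⟨n, ?_⟩
  ext ρ
  change b / (2 * Real.pi) * argCut (rel xhat (x + (ρ : Site k)))
    - b / (2 * Real.pi) * argCut (rel xhat x)
    = b / (2 * Real.pi) * (Complex.log (1 + (ρ : Site k) / rel xhat x)).im + n ρ * b
  rw [← mul_sub, hn, Complex.log_im, one_add_div_rel hx]
  field_simp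

theorem isBigO_of_components {α ι : Type*} [Fintype ι] {l : Filter α}
    {f : α → EuclideanSpace ℝ ι} {g : α → ℂ} (h : ∀ i, (fun x => f x i) =O[l] g) : f =O[l] g :=
  ((PiLp.continuousLinearEquiv 2 ℝ fun _ : ι => ℝ).symm.isBigO_comp
    (fun x => WithLp.ofLp (f x)) l).trans (isBigO_pi.2 h)

variable (R b xhat) in
theorem isBigO_elasticStrain_sub :
    (fun x => elasticStrain R b xhat x - leadingStrain R b xhat x)
      =O[cofinite] fun x => (rel xhat x)⁻¹ ^ 2 := by
  refine isBigO_of_components fun ρ => ?_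
  refine (((Complex.imCLM.isBigO_comp _ _).trans (isBigO_log_sub (ρ : Site k))).const_mul_left
    (b / (2 * Real.pi))).congr_left fun x => ?_
  rw [Complex.imCLM_apply, Complex.sub_im, mul_sub, div_eq_mul_inv _ (rel xhat x)]
  rfl

variable (R b xhat) in
theorem isBigO_elasticStrain :
    elasticStrain R b xhat =O[cofinite] fun x => (rel xhat x)⁻¹ := by
  have hlead : leadingStrain R b xhat =O[cofinite] fun x => (rel xhat x)⁻¹ :=
    isBigO_of_components fun ρ => ((Complex.imCLM.isBigO_comp _ _).trans
      ((isBigO_refl (fun x => (rel xhat x)⁻¹) _).const_mul_left _)).const_mul_left _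
  have hinv : (fun x : Site k => (rel xhat x)⁻¹) =O[cofinite] fun _ => (1 : ℂ) :=
    (tendsto_inv₀_cobounded.comp
      (tendsto_norm_atTop_iff_cobounded.1 (tendsto_norm_rel k xhat))).isBigO_one ℂ
  have hsq : (fun x : Site k => (rel xhat x)⁻¹ ^ 2) =O[cofinite] fun x => (rel xhat x)⁻¹ := by
    simpa only [sq, mul_one] using (isBigO_refl _ _).mul hinv
  exact (((isBigO_elasticStrain_sub R b xhat).trans hsq).add hlead).congr_left fun x =>
    sub_add_cancel _ _

open scoped Classical in
theorem clm_leadingStrain_single (H : EuclideanSpace ℝ R →L[ℝ] EuclideanSpace ℝ R →L[ℝ] ℝ)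
    (σ : R) (x : Site k) : H (leadingStrain R b xhat x) (EuclideanSpace.single σ 1)
      = b / (2 * Real.pi) * imInv xhat (stressCoeff H σ) x := by
  have hsum : leadingStrain R b xhat x = ∑ ρ : R,
      (b / (2 * Real.pi) * imInv xhat (ρ : Site k) x) • EuclideanSpace.single ρ (1 : ℝ) := by
    ext τ
    simp [leadingStrain, Pi.single_apply]
  rw [hsum, map_sum]
  simp only [map_smul, sum_apply, smul_apply, imInv_apply,
    stressCoeff, Finset.sum_mul, Complex.im_sum, Finset.mul_sum, smul_eq_mul]
  refine Finset.sum_congr rfl fun ρ _ => ?_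
  rw [mul_assoc (_ : ℂ), Complex.im_ofReal_mul]
  ring

variable {V : EuclideanSpace ℝ R → ℝ} {V' : EuclideanSpace ℝ R → EuclideanSpace ℝ R →L[ℝ] ℝ}
  {V'' : EuclideanSpace ℝ R → EuclideanSpace ℝ R →L[ℝ] EuclideanSpace ℝ R →L[ℝ] ℝ} {M : ℝ≥0}

theorem isBigO_stress (hV : TaylorBounds V V' V'' M) :
    (fun x => V' (elasticStrain R b xhat x) - V' 0 - V'' 0 (leadingStrain R b xhat x))
      =O[cofinite] fun x => (rel xhat x)⁻¹ ^ 2 := by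
  have hlin : (fun x => V' (elasticStrain R b xhat x) - V' 0 - V'' 0 (elasticStrain R b xhat x))
      =O[cofinite] fun x => (rel xhat x)⁻¹ ^ 2 := by
    refine (IsBigO.of_bound (g := fun x => ‖elasticStrain R b xhat x‖ ^ 2) M
      (.of_forall fun x => ?_)).trans ((isBigO_elasticStrain R b xhat).norm_left.pow 2)
    simpa using hV.norm_deriv_remainder_le 0 (elasticStrain R b xhat x)
  refine (hlin.add (((V'' 0).isBigO_comp _ _).trans
    (isBigO_elasticStrain_sub R b xhat))).congr_left fun x => ?_
  rw [map_sub, sub_add_sub_cancel]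

open scoped Classical in
theorem mkQ_bondForce_stress (hV : TaylorBounds V V' V'' M) (hslip : SlipInvariant b V')
    (hR : AddSubgroup.closure (R : Set (Site k)) = ⊤) (hx : xhat ∉ lattice k) {uPred : Site k → ℝ}
    {w : HDot R} (hPred : ∀ x, uPred x = uHat b xhat x + w x) (σ : R) :
    (boundedForces R).mkQ
        (bondForce (σ : Site k) fun x => V' (grad R uPred x) (EuclideanSpace.single σ 1))
      = (b / (2 * Real.pi)) • forceClass R xhat (σ : Site k) (stressCoeff (V'' 0) σ) := by
  set e : EuclideanSpace ℝ R := EuclideanSpace.single σ 1 with he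
  have norm_apply_le : ∀ φ : EuclideanSpace ℝ R →L[ℝ] ℝ, ‖φ e‖ ≤ ‖φ‖ := fun φ =>
    φ.unit_le_opNorm e (by simp [he])
  have hcorrector : Summable fun x =>
      (V' (grad R uPred x) e - V' (elasticStrain R b xhat x) e) ^ 2 := by
    refine .of_nonneg_of_le (fun x => sq_nonneg _) (fun x => ?_)
      ((summable_norm_sq (gradL R w)).mul_left (M ^ 2 : ℝ))
    obtain ⟨n, hn⟩ := exists_grad_uHat_eq (R := R) b hx x
    have hgrad : grad R uPred x = grad R (uHat b xhat) x + gradL R w x := by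
      rw [show uPred = uHat b xhat + w.1 from funext hPred, grad_add]
      rfl
    rw [← hslip n (elasticStrain R b xhat x), ← hn, hgrad, ← sub_apply,
      ← sq_abs, ← mul_pow]
    exact pow_le_pow_left₀ (abs_nonneg _) ((norm_apply_le _).trans (hV.norm_deriv_sub_le _ _)) 2
  have hharmonic : Summable fun x => (V' (elasticStrain R b xhat x) e
      - (V' 0 e + b / (2 * Real.pi) * imInv xhat (stressCoeff (V'' 0) σ) x)) ^ 2 := by
    refine summable_sq_of_isBigO (xhat := xhat) ((isBigO_of_le _ fun x => ?_).trans
      (isBigO_stress hV (b := b)))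
    rw [← clm_leadingStrain_single, ← sub_sub]
    exact norm_apply_le (V' (elasticStrain R b xhat x) - V' 0
      - V'' 0 (leadingStrain R b xhat x))
  rw [mkQ_bondForce_congr hR _ hcorrector, mkQ_bondForce_congr hR _ hharmonic, forceClass_apply,
    ← map_smul, ← map_smul]
  congr 1
  funext x
  simp only [bondForce_apply, Pi.smul_apply, smul_eq_mul, add_sub_add_left_eq_sub]

theorem exists_force_eq (hV : TaylorBounds V V' V'' M) (hslip : SlipInvariant b V')
    (hR : AddSubgroup.closure (R : Set (Site k)) = ⊤) (hx : xhat ∉ lattice k) {uPred : Site k → ℝ}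
    {w : HDot R} (hPred : ∀ x, uPred x = uHat b xhat x + w x)
    (h₁ : ∑ σ : R, stressCoeff (V'' 0) σ * ((σ : Site k) : ℂ) = 0)
    (h₂ : (∑ σ : R, stressCoeff (V'' 0) σ * (starRingEnd ℂ) ((σ : Site k) : ℂ)).im = 0) :
    ∃ L : HDot R →L[ℝ] ℝ, ∀ v ∈ Hc R, L v = ∑' x, V' (grad R uPred x) (grad R v x) := by
  classical
  have hmem : ∑ σ : R, bondForce (σ : Site k)
      (fun x => V' (grad R uPred x) (EuclideanSpace.single σ 1)) ∈ boundedForces R := by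
    rw [← Submodule.Quotient.mk_eq_zero, ← Submodule.mkQ_apply, map_sum]
    simp only [mkQ_bondForce_stress hV hslip hR hx hPred, ← Finset.smul_sum]
    rw [sum_forceClass_eq_zero hR hx h₁ h₂, smul_zero]
  obtain ⟨L, hL⟩ := exists_continuousLinearMap_of_mem_boundedForces hmem
  exact ⟨L, fun v hv => (hL v hv).trans (tsum_clm_grad _ hv).symm⟩

end Predictor

end ScrewDislocation

end

open ScrewDislocation in
theorem theorem3p1_general {k : LatticeKind} {R : Finset (Site k)} {V : EuclideanSpace ℝ R → ℝ}
    (hR : AddSubgroup.closure (R : Set (Site k)) = ⊤) (hV : ContDiff ℝ 3 V)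
    (hrot : ∃ π : Equiv.Perm R, (∀ ρ : R, ((π ρ : Site k) : ℂ) = k.rot * ((ρ : Site k) : ℂ)) ∧
      ∀ A : EuclideanSpace ℝ R, V A = V (WithLp.toLp 2 fun ρ => A (π ρ)))
    {p : ℝ} (hp : 0 < p) (hslip : IsSlipPeriod R V p) (n : ℤ) {xhat : ℂ} (hx : xhat ∉ lattice k)
    {uPred : Site k → ℝ} {w : HDot R} (hPred : ∀ x, uPred x = uHat (n * p) xhat x + w x)
    {u : HDot R} (hmin : IsLocalMin (energy R V uPred) u)
    (hstab : ∃ c : ℝ, 0 < c ∧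
      ∀ v ∈ Hc R, c * ‖v‖ ^ 2 ≤ secondVariation (energy R V uPred) u v)
    {s : ℝ} (hs : 1 < s) {r : ℕ}
    (hdecay : ∃ C₀ r₀ : ℝ, ∀ x : Site k, r₀ ≤ ‖(x : ℂ)‖ →
      ‖grad R u x‖ ≤ C₀ * ‖(x : ℂ)‖ ^ (-s) * Real.log ‖(x : ℂ)‖ ^ r) :
    ∃ C R₀ c : ℝ, 0 < C ∧ 0 < R₀ ∧ 0 < c ∧
      ∀ ρ : ℝ, R₀ < ρ → ∀ Ω : Set (Site k), Ω.Finite →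
        (∀ x : Site k, ‖(x : ℂ)‖ < ρ → x ∈ Ω) →
        ∃ uR ∈ H0 R Ω, IsLocalMinOn (energy R V uPred) (H0 R Ω) uR ∧
          (∀ v ∈ H0 R Ω, c * ‖v‖ ^ 2 ≤ secondVariation (energy R V uPred) uR v) ∧
          ‖uR - u‖ ≤ C * ρ ^ (1 - s) * Real.log ρ ^ r := by
  classical
  obtain ⟨π, hrot, hπ⟩ := hrot
  obtain ⟨c, hc, hstab⟩ := hstab
  obtain ⟨C₀, r₀, hdecay⟩ := hdecay
  have hV₂ : ContDiff ℝ 2 V := hV.of_le (by norm_num)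
  obtain ⟨M, hVM⟩ := hslip.slipInvariant.exists_taylorBounds hp hV
  obtain ⟨E, E', E'', hE, hFE⟩ := exists_taylorBounds_energy hVM <|
    exists_force_eq hVM (hslip.slipInvariant.fderiv.int_mul n) hR hx hPred
      (sum_stressCoeff_mul_eq_zero hrot (fderiv_fderiv_zero_perm hV₂ hπ))
      (im_sum_stressCoeff_mul_conj (hV₂.contDiffAt.isSymmSndFDerivAt (by simp)).eq)
  obtain ⟨C, R₁, hC, htrunc⟩ := exists_truncation hR hs hdecay
  have hsmall : ∀ᶠ ρ in atTop, M * ((8 * M / c + 2) * (C * truncRate s r ρ)) < c / 8 := by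
    refine Tendsto.eventually_lt_const (by positivity : 0 < c / 8) ?_
    simpa using (((tendsto_truncRate hs r).const_mul C).const_mul (8 * M / c + 2)).const_mul (M : ℝ)
  obtain ⟨R₂, hR₂⟩ := eventually_atTop.1
    (hsmall.and ((eventually_ge_atTop R₁).and (eventually_gt_atTop 1)))
  refine ⟨(8 * M / c + 2) * C, max R₂ 1, c / 2, by positivity, by positivity, by positivity,
    fun ρ hρ Ω hΩ hball => ?_⟩
  obtain ⟨hρsmall, hρ₁, hρ1⟩ := hR₂ ρ ((le_max_left _ _).trans hρ.le)
  obtain ⟨a, ha, hau⟩ := htrunc ρ hρ₁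
  obtain ⟨uR, huR, huRmin, huRstab, huRu⟩ := exists_supercell_solution hE hFE
    (mem_closure_Hc_of_decay hR hs hdecay) hmin hc hstab hΩ
    ⟨ha.1, fun x hx => ha.2 x (mt (hball x) hx)⟩ (mul_pos hC (truncRate_pos s r hρ1)) hau hρsmall.le
  exact ⟨uR, huR, huRmin, huRstab, huRu.trans_eq (by rw [truncRate]; ring)⟩

theorem theorem3p1 {k : ScrewDislocation.LatticeKind}
    (R : Finset (ScrewDislocation.Site k)) (V : EuclideanSpace ℝ R → ℝ) (b : ℝ) (xhat : ℂ)
    (hmodel : ScrewDislocation.IsScrewModel R V b xhat)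
    -- the predictor differs from the far-field predictor by an element of the energy space
    (uPred : ScrewDislocation.Site k → ℝ) (w : ScrewDislocation.HDot R)
    (hPred : ∀ x, uPred x = ScrewDislocation.uHat b xhat x + w x)
    -- a strongly stable solution
    (u : ScrewDislocation.HDot R)
    (hmin : IsLocalMin (ScrewDislocation.energy R V uPred) u)
    (hstab : ∃ c : ℝ, 0 < c ∧ ∀ v ∈ ScrewDislocation.Hc R,
      c * ‖v‖ ^ 2 ≤
        ScrewDislocation.secondVariation (ScrewDislocation.energy R V uPred) u v)
    -- decay of its strain
    (s : ℝ) (hs : 1 < s) (r : ℕ) (hr : r = 0 ∨ r = 1)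
    (hdecay : ∃ C₀ r₀ : ℝ, ∀ x : ScrewDislocation.Site k, r₀ ≤ ‖(x : ℂ)‖ →
      ‖ScrewDislocation.grad R u x‖ ≤ C₀ * ‖(x : ℂ)‖ ^ (-s) * Real.log ‖(x : ℂ)‖ ^ r) :
    ∃ C R₀ c : ℝ, 0 < C ∧ 0 < R₀ ∧ 0 < c ∧
      ∀ ρ : ℝ, R₀ < ρ → ∀ Ω : Set (ScrewDislocation.Site k), Ω.Finite →
        (∀ x : ScrewDislocation.Site k, ‖(x : ℂ)‖ < ρ → x ∈ Ω) →
        ∃ uR ∈ ScrewDislocation.H0 R Ω,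
          IsLocalMinOn (ScrewDislocation.energy R V uPred) (ScrewDislocation.H0 R Ω) uR ∧
          (∀ v ∈ ScrewDislocation.H0 R Ω, c * ‖v‖ ^ 2 ≤
            ScrewDislocation.secondVariation (ScrewDislocation.energy R V uPred) uR v) ∧
          ‖uR - u‖ ≤ C * ρ ^ (1 - s) * Real.log ρ ^ r := by
  obtain ⟨p, ⟨⟨hp, hslip⟩, -⟩, hb⟩ := hmodel.burgers
  obtain ⟨n, rfl⟩ : ∃ n : ℤ, b = n * p := hb.elim (⟨1, by simpa using ·⟩) (⟨-1, by simpa using ·⟩)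
  exact theorem3p1_general hmodel.span_eq_top (hmodel.contDiff.of_le (by norm_num))
    hmodel.rotation hp hslip n hmodel.core_notMem hPred hmin hstab hs hdecay
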